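/- \textbf{Setting.} Let $Z$ be a random variable with values in a Polish space $\mathsf Z$, let $(Z_i)_{i\ge1}$ be i.i.d. copies of $Z$ on a probability space $(\Omega,\mathcal F,\mathbb P)$, and let $f:\mathbb R^d\times\mathsf Z\to\mathbb R$ be measurable with $\mathbb E|f(\theta,Z)|<\infty$ for all $\theta$. Put $F(\theta)=\mathbb E[f(\theta,Z)]$ and $F_n(\theta)=\frac1n\sum_{i=1}^n f(\theta,Z_i)$, and suppose that $F$ has a minimizer $\theta_\star$ on $\mathbb R^d$. Gradients and Hessians are taken in $\theta$. \textbf{A1.} For every compact $\Theta\subset\mathbb R^d$ there is $c_\Theta>0$ such that $F(a\theta_1+(1-a)\theta_2)\le aF(\theta_1)+(1-a)F(\theta_2)-\frac{c_\Theta}{2}a(1-a)\|\theta_1-\theta_2\|^2$ for all $a\in[0,1]$ and $\theta_1,\theta_2\in\Theta$. \textbf{A2} (with exponent $\alpha\in(0,1]$). For every $z$ the function $f(\cdot,z)$ is twice continuously differentiable; $\mathbb E\|\nabla^2 f(\theta_\star,Z)\|<\infty$ and $\mathbb E\|\nabla f(\theta_\star,Z)\|^{1+\alpha}<\infty$; and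 for every compact $\Theta\subset\mathbb R^d$ there is a measurable $M_\Theta:\mathsf Z\to[0,\infty)$ with $\mathbb E[M_\Theta(Z)]<\infty$ such that, almost surely, $\|\nabla^2 f(\theta,Z)-\nabla^2 f(\theta',Z)\|\le M_\Theta(Z)\|\theta-\theta'\|$ for all $\theta,\theta'\in\Theta$. \textbf{Algorithm} (gradient descent with backtracking line search, GD-BLS, on $F_n$ with budget $B$ and tolerance $0$). Let $C_{\mathrm{grad}},C_{\mathrm{eval}}$ be positive integers; an evaluation of $\nabla F_n$ costs $nC_{\mathrm{grad}}$ and an evaluation of $F_n$ costs $nC_{\mathrm{eval}}$, the cost of each evaluation is deducted from the remaining budget, initially $B$, and an evaluation is made only if the remaining budget covers it. Let $\theta_0\in\mathbb R^d$ and $\beta\in(0,1)$. First evaluate $G_0=\nabla F_n(\theta_0)$ and then $g_0=F_n(\theta_0)$ (if the budget is insufficient for $G_0$, the output is $\theta_0$). At step $t\geq 0$, if $G_t=0$ or the remaining budget is less than $nC_{\mathrm{eval}}$, stop and output $\theta_t$. Otherwise put $v=1$ and evaluate $g'=F_n(\theta_t-vG_t)$; while $g'>g_t-\frac v2\|G_t\|^2$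 and the remaining budget is at least $nC_{\mathrm{eval}}$, replace $v$ by $\beta v$ and evaluate $g'=F_n(\theta_t-vG_t)$ again. If after this $g'>g_t-\frac v2\|G_t\|^2$, stop and output $\theta_t$. Otherwise let $\theta_{t+1}=\theta_t-vG_t$ and $g_{t+1}=g'$; if the remaining budget is at least $nC_{\mathrm{grad}}$, evaluate $G_{t+1}=\nabla F_n(\theta_{t+1})$ and go to step $t+1$; otherwise stop and output $\theta_{t+1}$. \textbf{Theorem 1.} Assume A1 and A2 with exponent $\alpha\in(0,1]$. Let $\theta_0\in\mathbb R^d$, $\beta\in(0,1)$, and let $n:\mathbb N\to\mathbb N$ satisfy $n(B)\to\infty$ and $n(B)/B\to0$ as $B\to\infty$. For $B\in\mathbb N$ let $\tilde\theta_B$ be the output of GD-BLS on $F_{n(B)}$ with starting point $\theta_0$, budget $B$ and tolerance $0$, and let $$r(B)=\max\Big(\sqrt{n(B)/B},\;n(B)^{-\frac{\alpha}{1+\alpha}}\Big).$$ Then $\|\tilde\theta_B-\theta_\star\|=\mathcal O_{\mathbb P}(r(B))$, that is, for every $\epsilon\in(0,1)$ there is $M_\epsilon<\infty$ such that $\limsup_{B\to\infty}\mathbb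 P\big(\|\tilde\theta_B-\theta_\star\|/r(B)\ge M_\epsilon\big)\le\epsilon$. Moreover, $$\liminf_{B\to\infty}B^{\frac{\alpha}{1+3\alpha}}\,r(B)>0 .$$ -/

import Mathlib

open MeasureTheory ProbabilityTheory Filter Topology Set

namespace GDBLS

section Optimization

variable {d : ℕ} {Ω 𝒵 : Type*} [MeasurableSpace Ω] [MeasurableSpace 𝒵]

/-- The objective function `F θ = E[f(θ, Z)]`. -/
noncomputable def objective (P : Measure Ω) (Z : Ω → 𝒵)
    (f : EuclideanSpace ℝ (Fin d) → 𝒵 → ℝ) (θ : EuclideanSpace ℝ (Fin d)) : ℝ :=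
  ∫ ω, f θ (Z ω) ∂P

/-- The gradient of `f(·, z)` at `θ`. -/
noncomputable def grad (f : EuclideanSpace ℝ (Fin d) → 𝒵 → ℝ)
    (θ : EuclideanSpace ℝ (Fin d)) (z : 𝒵) : EuclideanSpace ℝ (Fin d) :=
  gradient (fun x => f x z) θ

/-- The Hessian of `f(·, z)` at `θ`, as a linear operator (with the operator norm). -/
noncomputable def hess (f : EuclideanSpace ℝ (Fin d) → 𝒵 → ℝ)
    (θ : EuclideanSpace ℝ (Fin d)) (z : 𝒵) :
    EuclideanSpace ℝ (Fin d) →L[ℝ] EuclideanSpace ℝ (Fin d) :=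
  fderiv ℝ (fun x => grad f x z) θ

/-- Local strong convexity: strong convexity inequality on every compact set, with a constant
that may depend on the compact set. -/
def LocallyStronglyConvex (F : EuclideanSpace ℝ (Fin d) → ℝ) : Prop :=
  ∀ Θ : Set (EuclideanSpace ℝ (Fin d)), IsCompact Θ → ∃ c : ℝ, 0 < c ∧
    ∀ a ∈ Icc (0 : ℝ) 1, ∀ θ₁ ∈ Θ, ∀ θ₂ ∈ Θ,
      F (a • θ₁ + (1 - a) • θ₂) ≤
        a * F θ₁ + (1 - a) * F θ₂ - c / 2 * a * (1 - a) * ‖θ₁ - θ₂‖ ^ 2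

/-- Smoothness and moment assumption, with exponent `α`, on the function `f` and the random
variable `Z`, at the point `θs` (the minimizer). -/
structure SmoothMoment (P : Measure Ω) (Z : Ω → 𝒵)
    (f : EuclideanSpace ℝ (Fin d) → 𝒵 → ℝ) (θs : EuclideanSpace ℝ (Fin d)) (α : ℝ) : Prop where
  contDiff : ∀ z, ContDiff ℝ 2 (fun θ => f θ z)
  hess_integrable : Integrable (fun ω => ‖hess f θs (Z ω)‖) P
  grad_integrable : Integrable (fun ω => ‖grad f θs (Z ω)‖ ^ (1 + α)) P
  hess_lipschitz : ∀ Θ : Set (EuclideanSpace ℝ (Fin d)), IsCompact Θ →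
    ∃ M : 𝒵 → ℝ, Measurable M ∧ (∀ z, 0 ≤ M z) ∧ Integrable (fun ω => M (Z ω)) P ∧
      ∀ᵐ ω ∂P, ∀ θ ∈ Θ, ∀ θ' ∈ Θ,
        ‖hess f θ (Z ω) - hess f θ' (Z ω)‖ ≤ M (Z ω) * ‖θ - θ'‖

/-- The sample average `F_n = n⁻¹ ∑_{i ≤ n} f(·, Z_i)`; the sample `Z_1, Z_2, …` is
`zs 0, zs 1, …`. -/
noncomputable def sampleAverage (f : EuclideanSpace ℝ (Fin d) → 𝒵 → ℝ) (zs : ℕ → 𝒵) (n : ℕ)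
    (θ : EuclideanSpace ℝ (Fin d)) : ℝ :=
  (1 / (n : ℝ)) * ∑ i ∈ Finset.range n, f θ (zs i)

end Optimization

section Algorithm

variable {d : ℕ}

open Classical in
/-- The backtracking (inner) loop, for a function `g` one evaluation of which costs `cE`:
`θ`, `G`, `gt` are the current point, its gradient and its function value; `v`, `gv` are the
current step size and the value of `g` at `θ - v • G`; `b` is the remaining budget.
Returns the final `(v, gv, b)`. (The clause `0 < cE` only makes the recursion total.) -/
noncomputable def backtrack (g : EuclideanSpace ℝ (Fin d) → ℝ) (cE : ℕ) (β : ℝ)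
    (θ G : EuclideanSpace ℝ (Fin d)) (gt : ℝ) (v gv : ℝ) (b : ℕ) : ℝ × ℝ × ℕ :=
  if _h : (gv > gt - v / 2 * ‖G‖ ^ 2 ∧ cE ≤ b) ∧ 0 < cE then
    backtrack g cE β θ G gt (β * v) (g (θ - (β * v) • G)) (b - cE)
  else (v, gv, b)
termination_by b
decreasing_by omega

theorem backtrack_budget_le (g : EuclideanSpace ℝ (Fin d) → ℝ) (cE : ℕ) (β : ℝ)
    (θ G : EuclideanSpace ℝ (Fin d)) (gt : ℝ) (v gv : ℝ) (b : ℕ) :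
    (backtrack g cE β θ G gt v gv b).2.2 ≤ b := by
  induction b using Nat.strong_induction_on generalizing v gv with
  | _ b ih =>
    rw [backtrack]
    split_ifs with h
    · exact (ih (b - cE) (by omega) _ _).trans (Nat.sub_le _ _)
    · exact le_rfl

open Classical in
/-- The main loop: gradient descent on `g` with backtracking line search, with remaining
budget `b`, at the point `θ` with gradient `G` and function value `gt`. One evaluation of `g`
costs `cE` and one evaluation of its gradient costs `cG`. The loop stops when `‖G‖ ≤ τ` or
when the budget does not allow another evaluation. Returns the last point and the unused
budget. (The clause `0 < cE` only makes the recursion total.) -/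
noncomputable def descentLoop (g : EuclideanSpace ℝ (Fin d) → ℝ) (cG cE : ℕ) (τ β : ℝ)
    (θ G : EuclideanSpace ℝ (Fin d)) (gt : ℝ) (b : ℕ) : EuclideanSpace ℝ (Fin d) × ℕ :=
  if _h : (‖G‖ > τ ∧ cE ≤ b) ∧ 0 < cE then
    let s := backtrack g cE β θ G gt 1 (g (θ - G)) (b - cE)
    if s.2.1 ≤ gt - s.1 / 2 * ‖G‖ ^ 2 then
      let θ' := θ - s.1 • G
      if cG ≤ s.2.2 then
        descentLoop g cG cE τ β θ' (gradient g θ') s.2.1 (s.2.2 - cG)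
      else (θ', s.2.2)
    else descentLoop g cG cE τ β θ G gt s.2.2
  else (θ, b)
termination_by b
decreasing_by
  all_goals
    have hs := backtrack_budget_le g cE β θ G gt 1 (g (θ - G)) (b - cE)
    omega

/-- GD-BLS on the sample average `F_n` with budget `B`, tolerance `τ` and backtracking parameter
`β`: one evaluation of `∇F_n` costs `n * Cgrad`, one evaluation of `F_n` costs `n * Ceval`.
If the budget does not even allow the initial gradient, that gradient is set to `0`, so that
`θ₀` is returned. Returns the estimate and the unused budget. -/
noncomputable def gdBLS {𝒵 : Type*} (Cgrad Ceval : ℕ) (f : EuclideanSpace ℝ (Fin d) → 𝒵 → ℝ)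
    (zs : ℕ → 𝒵) (θ₀ : EuclideanSpace ℝ (Fin d)) (n B : ℕ) (τ β : ℝ) :
    EuclideanSpace ℝ (Fin d) × ℕ :=
  let g := sampleAverage f zs n
  let cG := n * Cgrad
  let cE := n * Ceval
  let G := if cG ≤ B then gradient g θ₀ else 0
  let B₁ := if cG ≤ B then B - cG else B
  let gt := if cE ≤ B₁ then g θ₀ else 0
  let B₂ := if cE ≤ B₁ then B₁ - cE else B₁
  descentLoop g cG cE τ β θ₀ G gt B₂

end Algorithm

/-- `X_t = O_P(a_t)`: for all `ε ∈ (0,1)` there is a finite `M` such that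
`limsup_t P(|X_t / a_t| ≥ M) ≤ ε`. -/
def IsBigOInProb {Ω : Type*} [MeasurableSpace Ω] (P : Measure Ω) (X : ℕ → Ω → ℝ) (a : ℕ → ℝ) :
    Prop :=
  ∀ ε ∈ Ioo (0 : ℝ) 1, ∃ M : ℝ,
    limsup (fun t => P {ω | M ≤ |X t ω / a t|}) atTop ≤ ENNReal.ofReal ε

/-- The rate `r(B) = max(√(n(B)/B), n(B)^{-α/(1+α)})`. -/
noncomputable def rate (α : ℝ) (n : ℕ → ℕ) (B : ℕ) : ℝ :=
  max (Real.sqrt ((n B : ℝ) / (B : ℝ))) ((n B : ℝ) ^ (-(α / (1 + α))))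

end GDBLS

/-! The proof separates a deterministic analysis of the algorithm from the probability, and compares
the output with `θs` directly, without a minimizer of `F_n`.

Deterministic part. Let `g` be strongly convex and smooth on balls around `x₀`, with `∇g(x₀)` small.
Sublevel sets then stay in a fixed ball, gradients there are bounded, and a fixed power `β ^ k`
passes every line search test. Hence each iteration costs a bounded number of evaluations and
contracts the positive part of `g x - g x₀` by a fixed factor: the gap decays exponentially in the
budget divided by the cost of an iteration. Strong convexity at `x₀` turns this into a bound on the
squared distance to `x₀` by a multiple of `‖∇g(x₀)‖²` plus the exponential term (`descentLoop_spec`,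
`descentLoop_error`).

Probabilistic part. A1 bounds the expected Hessian below. The strong law on a finite net, with the
integrable Lipschitz constant of the Hessian, carries this to `F_n` with probability tending to one
(`SmoothMoment.exists_quadBounds`). Since `∇f(θs, Z)` is centered, a von Bahr–Esseen inequality with
exponent `1 + α` gives `‖∇F_n(θs)‖ = O_P(n^(-α/(1+α)))` (`SmoothMoment.measure_gradient_gt_le`).

Combination. One iteration costs a constant times `n`, so the exponential term is `exp(-const * B /
n)`, which is at most a constant times `n / B`. Both terms are then of order `r(B)²`. The lower
bound on `r(B)` comes from balancing its two terms (`one_le_mul_rate`). -/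

namespace GDBLS

open scoped RealInnerProductSpace

/-! ### Deterministic analysis of the two loops. -/

variable {d : ℕ}

/-- The induction is on `r`, the number of trials left before the exponent `k`, where the test is
known to pass. So the loop either accepts some exponent `i ≤ k` or runs out of budget, and it pays
for at most `r` further evaluations. -/
theorem backtrack_spec (g : EuclideanSpace ℝ (Fin d) → ℝ) {cE : ℕ} (hcE : 0 < cE) (β : ℝ)
    (θ G : EuclideanSpace ℝ (Fin d)) (gt : ℝ) (k : ℕ)
    (hk : g (θ - β ^ k • G) ≤ gt - β ^ k / 2 * ‖G‖ ^ 2) (r : ℕ) :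
    ∀ j b : ℕ, j + r = k → ∃ i ≤ k, ∃ b', backtrack g cE β θ G gt (β ^ j) (g (θ - β ^ j • G)) b
        = (β ^ i, g (θ - β ^ i • G), b') ∧ b ≤ b' + r * cE ∧ b' ≤ b ∧
        (g (θ - β ^ i • G) ≤ gt - β ^ i / 2 * ‖G‖ ^ 2 ∨ b' < cE) := by
  induction r with
  | zero =>
    intro j b hj
    obtain rfl : j = k := by omega
    refine ⟨j, le_rfl, b, ?_, by omega, le_rfl, Or.inl hk⟩
    rw [backtrack, dif_neg]
    rintro ⟨⟨h, -⟩, -⟩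
    exact absurd hk (not_le.mpr h)
  | succ r ih =>
    intro j b hj
    rw [backtrack]
    split_ifs with h
    · obtain ⟨i, hi, b', h1, h2, h3, h4⟩ := ih (j + 1) (b - cE) (by omega)
      rw [pow_succ'] at h1
      refine ⟨i, hi, b', h1, ?_, by omega, h4⟩
      have := h.1.2
      rw [add_mul, one_mul]
      omega
    · refine ⟨j, by omega, b, rfl, by omega, le_rfl, ?_⟩
      by_contra! hc
      exact h ⟨⟨hc.1, hc.2⟩, hcE⟩

theorem descentLoop_of_budget_lt (g : EuclideanSpace ℝ (Fin d) → ℝ) (cG cE : ℕ) (τ β : ℝ)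
    (θ G : EuclideanSpace ℝ (Fin d)) (gt : ℝ) (b : ℕ) (hb : b < cE) :
    descentLoop g cG cE τ β θ G gt b = (θ, b) := by
  rw [descentLoop, dif_neg]
  rintro ⟨⟨-, h⟩, -⟩
  omega

/-- Linear convergence of the main loop on an invariant set `S` on which a Polyak–Łojasiewicz
inequality holds and the step size `β ^ k` passes the line search test. -/
theorem descentLoop_spec (g : EuclideanSpace ℝ (Fin d) → ℝ) (cG : ℕ) {cE : ℕ} (hcE : 0 < cE)
    {β : ℝ} (hβ : β ∈ Ioo (0 : ℝ) 1) (k : ℕ) (S : Set (EuclideanSpace ℝ (Fin d))) (m c : ℝ)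
    (hc : 0 ≤ c)
    (hstay : ∀ x ∈ S, ∀ v ∈ Icc (0 : ℝ) 1,
      g (x - v • gradient g x) ≤ g x → x - v • gradient g x ∈ S)
    (hk : ∀ x ∈ S, g (x - β ^ k • gradient g x) ≤ g x - β ^ k / 2 * ‖gradient g x‖ ^ 2)
    (hPL : ∀ x ∈ S, 2 * c * (g x - m) ≤ ‖gradient g x‖ ^ 2) (b : ℕ) :
    ∀ x ∈ S, (descentLoop g cG cE 0 β x (gradient g x) (g x) b).1 ∈ S ∧
      max (g (descentLoop g cG cE 0 β x (gradient g x) (g x) b).1 - m) 0 ≤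
        Real.exp (β ^ k * c - β ^ k * c * (b / ((k + 2) * cE + cG : ℕ))) * max (g x - m) 0 := by
  have hβk : 0 < β ^ k := pow_pos hβ.1 k
  have hκ : 0 ≤ β ^ k * c := by positivity
  set κ := β ^ k * c with hκdef
  -- One pass costs at most `(k + 1) * cE + cG`: the first trial, `k` backtracks and a gradient. The
  -- extra `cE` covers a remainder too small for one more evaluation, so that every stop with a
  -- nonzero gradient has `b ≤ N`.
  set N : ℕ := (k + 2) * cE + cG with hN
  have hNpos : 0 < N := by positivity
  have hNpos' : (0 : ℝ) < N := by exact_mod_cast hNpos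
  -- The additive `κ` in the exponent pays for the last, possibly unfinished pass: with a budget of
  -- at most `N` the claimed factor is at least one, and not increasing the gap is enough.
  have hsmall : ∀ b : ℕ, b ≤ N → 1 ≤ Real.exp (κ - κ * (b / N)) := by
    intro b hb
    apply Real.one_le_exp
    have : (b : ℝ) / N ≤ 1 := by
      rw [div_le_one hNpos']; exact_mod_cast hb
    nlinarith
  induction b using Nat.strong_induction_on with
  | _ b ih =>
    intro x hx
    have hm0 : 0 ≤ max (g x - m) 0 := le_max_right _ _
    rw [descentLoop]
    split_ifs with h
    · obtain ⟨i, hi, b', h1, h2, h3, h4⟩ := backtrack_spec g hcE β x (gradient g x) (g x) k (hk x hx)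
        k 0 (b - cE) (by omega)
      simp only [pow_zero, one_smul] at h1
      have hcb := h.1.2
      have hbb : b ≤ b' + (k + 1) * cE := by
        rw [add_mul, one_mul]; omega
      have hi1 : β ^ i ≤ 1 := pow_le_one₀ hβ.1.le hβ.2.le
      have hik : β ^ k ≤ β ^ i := pow_le_pow_of_le_one hβ.1.le hβ.2.le hi
      have hi0 : 0 < β ^ i := pow_pos hβ.1 i
      simp only [h1]
      by_cases hs : g (x - β ^ i • gradient g x) ≤ g x - β ^ i / 2 * ‖gradient g x‖ ^ 2
      · rw [if_pos hs]
        have hle : g (x - β ^ i • gradient g x) ≤ g x := hs.trans (by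
          have : 0 ≤ β ^ i / 2 * ‖gradient g x‖ ^ 2 := by positivity
          linarith)
        have hmem := hstay x hx (β ^ i) ⟨hi0.le, hi1⟩ hle
        have hdec : max (g (x - β ^ i • gradient g x) - m) 0
            ≤ Real.exp (-κ) * max (g x - m) 0 := by
          apply max_le _ (by positivity)
          rcases le_or_gt 0 (g x - m) with hpos | hneg
          · rw [max_eq_left hpos]
            have e1 : 1 - κ ≤ Real.exp (-κ) := by linarith [Real.add_one_le_exp (-κ)]
            have e2 := hPL x hx
            have e3 : β ^ k / 2 * ‖gradient g x‖ ^ 2 ≤ β ^ i / 2 * ‖gradient g x‖ ^ 2 := by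
              gcongr
            have e4 : β ^ k / 2 * (2 * c * (g x - m)) ≤ β ^ k / 2 * ‖gradient g x‖ ^ 2 := by
              gcongr
            have e5 : (1 - κ) * (g x - m) ≤ Real.exp (-κ) * (g x - m) := by gcongr
            have e6 : β ^ k / 2 * (2 * c * (g x - m)) = κ * (g x - m) := by rw [hκdef]; ring
            linarith
          · rw [max_eq_right hneg.le]; linarith
        split_ifs with hG
        · obtain ⟨i1, i2⟩ := ih (b' - cG) (by omega) _ hmem
          refine ⟨i1, i2.trans ?_⟩
          have e1 : (b : ℝ) / N ≤ (b' - cG : ℕ) / N + 1 := by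
            rw [div_add_one hNpos'.ne']
            gcongr
            have : b ≤ (b' - cG) + N := by
              rw [hN]
              have : (k + 2) * cE = (k + 1) * cE + cE := by ring
              omega
            exact_mod_cast this
          calc _ ≤ Real.exp (κ - κ * ((b' - cG : ℕ) / N)) *
                (Real.exp (-κ) * max (g x - m) 0) := by gcongr
            _ = Real.exp (κ - κ * ((b' - cG : ℕ) / N) + -κ) * max (g x - m) 0 := by
                rw [Real.exp_add]; ring
            _ ≤ _ := by
                gcongr
                nlinarith
        · refine ⟨hmem, ?_⟩
          have hbN : b ≤ N := by
            rw [hN]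
            have : (k + 2) * cE = (k + 1) * cE + cE := by ring
            omega
          have e1 := hsmall b hbN
          have e2 : Real.exp (-κ) ≤ 1 := Real.exp_le_one_iff.mpr (by linarith)
          exact hdec.trans (mul_le_mul_of_nonneg_right (e2.trans e1) hm0)
      · rw [if_neg hs]
        have hb' : b' < cE := h4.resolve_left hs
        rw [descentLoop_of_budget_lt _ _ _ _ _ _ _ _ _ hb']
        refine ⟨hx, ?_⟩
        have hbN : b ≤ N := by
          rw [hN]
          have : (k + 2) * cE = (k + 1) * cE + cE := by ring
          omega
        exact le_mul_of_one_le_left hm0 (hsmall b hbN)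
    · refine ⟨hx, ?_⟩
      by_cases hG : ‖gradient g x‖ > 0
      · have hb : b < cE := by
          by_contra! hcon
          exact h ⟨⟨hG, hcon⟩, hcE⟩
        have hbN : b ≤ N := by
          rw [hN]
          have : (k + 2) * cE = (k + 1) * cE + cE := by ring
          omega
        exact le_mul_of_one_le_left hm0 (hsmall b hbN)
      -- Stopping with budget left requires a zero gradient. If `c > 0`, the Polyak–Łojasiewicz
      -- inequality then makes the positive part of the gap vanish; if `c = 0`, the claimed factor
      -- is one.
      · have h0 : ‖gradient g x‖ = 0 := le_antisymm (not_lt.mp hG) (norm_nonneg _)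
        have := hk x hx
        rcases hc.eq_or_lt with hc0 | hc0
        · have : κ = 0 := by rw [hκdef, ← hc0, mul_zero]
          simp [this]
        · have e := hPL x hx
          rw [h0] at e
          have : g x - m ≤ 0 := by
            by_contra! hcon
            have : 0 < 2 * c * (g x - m) := by positivity
            norm_num at e
            linarith
          rw [max_eq_right this, mul_zero]

/-! ### Consequences of two-sided quadratic bounds. -/

/-- Two-sided quadratic bounds on the remainder of the first order expansion of `g` on the closed
ball of radius `ρ` around `x₀`. -/
def QuadBounds (g : EuclideanSpace ℝ (Fin d) → ℝ) (x₀ : EuclideanSpace ℝ (Fin d))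
    (ρ c L : ℝ) : Prop :=
  ∀ x ∈ Metric.closedBall x₀ ρ, ∀ y ∈ Metric.closedBall x₀ ρ,
    c / 2 * ‖y - x‖ ^ 2 ≤ g y - g x - ⟪gradient g x, y - x⟫ ∧
      g y - g x - ⟪gradient g x, y - x⟫ ≤ L / 2 * ‖y - x‖ ^ 2

/-- The comparison point `y` is arbitrary, not a minimizer. This allows `y = x₀`, and it is why the
gap is truncated at zero in `descentLoop_spec`. -/
theorem QuadBounds.polyak {g : EuclideanSpace ℝ (Fin d) → ℝ} {x₀ : EuclideanSpace ℝ (Fin d)}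
    {ρ c L : ℝ} (h : QuadBounds g x₀ ρ c L) {x y : EuclideanSpace ℝ (Fin d)}
    (hc : 0 < c) (hx : x ∈ Metric.closedBall x₀ ρ) (hy : y ∈ Metric.closedBall x₀ ρ) :
    2 * c * (g x - g y) ≤ ‖gradient g x‖ ^ 2 := by
  have h1 := (h x hx y hy).1
  have h2 := abs_le.mp (abs_real_inner_le_norm (gradient g x) (y - x))
  have h3 : g x - g y ≤ ‖gradient g x‖ * ‖y - x‖ - c / 2 * ‖y - x‖ ^ 2 := by linarith [h2.1]
  nlinarith [sq_nonneg (‖gradient g x‖ - c * ‖y - x‖)]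

/-- Strong convexity at `x₀`, with the linear term absorbed by Young's inequality. The nonzero
gradient at `x₀` is the statistical error. -/
theorem QuadBounds.dist_sq_le {g : EuclideanSpace ℝ (Fin d) → ℝ}
    {x₀ : EuclideanSpace ℝ (Fin d)} {ρ c L : ℝ} (h : QuadBounds g x₀ ρ c L) (hρ : 0 ≤ ρ)
    {x : EuclideanSpace ℝ (Fin d)} (hc : 0 < c) (hx : x ∈ Metric.closedBall x₀ ρ) :
    ‖x - x₀‖ ^ 2 ≤ 4 / c ^ 2 * ‖gradient g x₀‖ ^ 2 + 4 / c * (g x - g x₀) := by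
  have h1 := (h x₀ (Metric.mem_closedBall_self hρ) x hx).1
  have h2 := abs_le.mp (abs_real_inner_le_norm (gradient g x₀) (x - x₀))
  have h3 : c / 2 * ‖x - x₀‖ ^ 2 ≤ ‖gradient g x₀‖ * ‖x - x₀‖ + (g x - g x₀) := by linarith [h2.1]
  have h4 : c ^ 2 * ‖x - x₀‖ ^ 2 ≤ 4 * ‖gradient g x₀‖ ^ 2 + 4 * c * (g x - g x₀) := by
    nlinarith [sq_nonneg (2 * ‖gradient g x₀‖ - c * ‖x - x₀‖)]
  have : 4 / c ^ 2 * ‖gradient g x₀‖ ^ 2 + 4 / c * (g x - g x₀)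
      = (4 * ‖gradient g x₀‖ ^ 2 + 4 * c * (g x - g x₀)) / c ^ 2 := by
    field_simp
  rw [this, le_div_iff₀ (by positivity)]
  linarith

/-- Linear growth away from `x₀`, from strong convexity near `x₀` and convexity elsewhere. -/
theorem QuadBounds.linear_growth {g : EuclideanSpace ℝ (Fin d) → ℝ}
    {x₀ : EuclideanSpace ℝ (Fin d)} {ρ₁ c₁ L₁ ρ c L : ℝ} (h₁ : QuadBounds g x₀ ρ₁ c₁ L₁)
    (hρ₁ : 1 ≤ ρ₁) (h : QuadBounds g x₀ ρ c L) (hc : 0 < c)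
    (hγ : ‖gradient g x₀‖ ≤ c₁ / 4) {x : EuclideanSpace ℝ (Fin d)}
    (hx : x ∈ Metric.closedBall x₀ ρ) (hx1 : 1 ≤ ‖x - x₀‖) :
    c₁ / 4 * ‖x - x₀‖ ≤ g x - g x₀ := by
  set D := ‖x - x₀‖ with hD
  have hDpos : 0 < D := by linarith
  have hxρ : D ≤ ρ := by rwa [mem_closedBall_iff_norm] at hx
  -- Growth by at least `c₁ / 4` is obtained on the unit sphere, inside the small ball. Convexity
  -- along the segment from `x₀` to `x` then propagates it linearly. The slope depends on `c₁` only,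
  -- not on the constant `c` of the large ball.
  set y := x₀ + D⁻¹ • (x - x₀) with hy
  have hyx : y - x₀ = D⁻¹ • (x - x₀) := by simp [hy]
  have hyn : ‖y - x₀‖ = 1 := by
    rw [hyx, norm_smul, Real.norm_of_nonneg (by positivity), ← hD, inv_mul_cancel₀ hDpos.ne']
  have hyρ : y ∈ Metric.closedBall x₀ ρ := by
    rw [mem_closedBall_iff_norm, hyn]; linarith
  have hyρ₁ : y ∈ Metric.closedBall x₀ ρ₁ := by
    rw [mem_closedBall_iff_norm, hyn]; exact hρ₁
  have a1 := (h₁ x₀ (Metric.mem_closedBall_self (by linarith)) y hyρ₁).1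
  have a2 := abs_le.mp (abs_real_inner_le_norm (gradient g x₀) (y - x₀))
  rw [hyn] at a1 a2
  have a3 : c₁ / 4 ≤ g y - g x₀ := by linarith [a2.1]
  have b1 := (h y hyρ x hx).1
  have b2 := (h y hyρ x₀ (Metric.mem_closedBall_self (by linarith))).1
  have e1 : x - y = (1 - D⁻¹) • (x - x₀) := by
    rw [sub_smul, one_smul, hy]; abel
  have e2 : x₀ - y = (-D⁻¹) • (x - x₀) := by
    rw [neg_smul, ← hyx]; abel
  have p1 : 0 ≤ c / 2 * ‖x - y‖ ^ 2 := by positivity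
  have p2 : 0 ≤ c / 2 * ‖x₀ - y‖ ^ 2 := by positivity
  have b1' := p1.trans b1
  have b2' := p2.trans b2
  rw [e1, inner_smul_right] at b1'
  rw [e2, inner_smul_right] at b2'
  set I := ⟪gradient g y, x - x₀⟫
  have hi0 : 0 < D⁻¹ := by positivity
  have hi1 : D⁻¹ ≤ 1 := inv_le_one_of_one_le₀ hx1
  have c1 := mul_nonneg hi0.le b1'
  have c2 := mul_nonneg (sub_nonneg.mpr hi1) b2'
  have c3 : g y - g x₀ ≤ D⁻¹ * (g x - g x₀) := by nlinarith
  have c4 : c₁ / 4 ≤ D⁻¹ * (g x - g x₀) := a3.trans c3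
  calc c₁ / 4 * D ≤ D⁻¹ * (g x - g x₀) * D := by gcongr
    _ = g x - g x₀ := by field_simp

/-- By convexity, a unit step `w` along the normalized gradient raises `g` by at least `‖∇g(x)‖`,
while the expansions at `x₀` bound `g (x + w) - g x` above. The step is the reason for the radius `R
+ 1`. -/
theorem QuadBounds.norm_gradient_le {g : EuclideanSpace ℝ (Fin d) → ℝ}
    {x₀ : EuclideanSpace ℝ (Fin d)} {R c L : ℝ} (h : QuadBounds g x₀ (R + 1) c L) (hR : 0 ≤ R)
    (hc : 0 < c) (hL : 0 ≤ L) {x : EuclideanSpace ℝ (Fin d)}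
    (hx : x ∈ Metric.closedBall x₀ R) :
    ‖gradient g x‖ ≤ ‖gradient g x₀‖ * (2 * R + 1) + L / 2 * (R + 1) ^ 2 := by
  have hpos : 0 ≤ ‖gradient g x₀‖ * (2 * R + 1) + L / 2 * (R + 1) ^ 2 := by positivity
  rcases eq_or_ne (gradient g x) 0 with h0 | h0
  · rw [h0, norm_zero]; exact hpos
  have hn : 0 < ‖gradient g x‖ := norm_pos_iff.mpr h0
  set w := ‖gradient g x‖⁻¹ • gradient g x with hw
  have hwn : ‖w‖ = 1 := by
    rw [hw, norm_smul, norm_inv, norm_norm, inv_mul_cancel₀ hn.ne']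
  have hxR : ‖x - x₀‖ ≤ R := by rwa [mem_closedBall_iff_norm] at hx
  have hx' : x ∈ Metric.closedBall x₀ (R + 1) := by
    rw [mem_closedBall_iff_norm]; linarith
  have hx₀ : x₀ ∈ Metric.closedBall x₀ (R + 1) := Metric.mem_closedBall_self (by linarith)
  have hyn : ‖x + w - x₀‖ ≤ R + 1 := by
    rw [add_sub_right_comm]
    exact (norm_add_le _ _).trans (by linarith)
  have hy : x + w ∈ Metric.closedBall x₀ (R + 1) := by
    rwa [mem_closedBall_iff_norm]
  have a1 := (h x hx' _ hy).1
  have a2 := (h x₀ hx₀ _ hy).2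
  have a3 := (h x₀ hx₀ _ hx').1
  have p1 : 0 ≤ c / 2 * ‖x + w - x‖ ^ 2 := by positivity
  have p3 : 0 ≤ c / 2 * ‖x - x₀‖ ^ 2 := by positivity
  have i1 : ⟪gradient g x, x + w - x⟫ = ‖gradient g x‖ := by
    rw [add_sub_cancel_left, hw, inner_smul_right, real_inner_self_eq_norm_sq]
    field_simp
  have i2 := abs_le.mp (abs_real_inner_le_norm (gradient g x₀) (x + w - x₀))
  have i3 := abs_le.mp (abs_real_inner_le_norm (gradient g x₀) (x - x₀))
  have j2 : ‖gradient g x₀‖ * ‖x + w - x₀‖ ≤ ‖gradient g x₀‖ * (R + 1) := by gcongr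
  have j3 : ‖gradient g x₀‖ * ‖x - x₀‖ ≤ ‖gradient g x₀‖ * R := by gcongr
  have j4 : L / 2 * ‖x + w - x₀‖ ^ 2 ≤ L / 2 * (R + 1) ^ 2 := by gcongr
  rw [i1] at a1
  linarith [i2.2, i3.1]

theorem QuadBounds.sufficient_decrease {g : EuclideanSpace ℝ (Fin d) → ℝ}
    {x₀ : EuclideanSpace ℝ (Fin d)} {ρ c L : ℝ} (h : QuadBounds g x₀ ρ c L)
    {x : EuclideanSpace ℝ (Fin d)} {v : ℝ} (hx : x ∈ Metric.closedBall x₀ ρ) (hv : 0 ≤ v)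
    (hvL : L * v ≤ 1) (hy : x - v • gradient g x ∈ Metric.closedBall x₀ ρ) :
    g (x - v • gradient g x) ≤ g x - v / 2 * ‖gradient g x‖ ^ 2 := by
  have a := (h x hx _ hy).2
  rw [sub_sub_cancel_left, norm_neg, norm_smul, inner_neg_right, inner_smul_right,
    real_inner_self_eq_norm_sq, Real.norm_of_nonneg hv] at a
  have : L * v * (v * ‖gradient g x‖ ^ 2) ≤ 1 * (v * ‖gradient g x‖ ^ 2) := by gcongr
  nlinarith

/-- Error bound for the whole algorithm on a function that satisfies quadratic bounds on three
suitable balls around `x₀`. -/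
theorem descentLoop_error {β : ℝ} (hβ : β ∈ Ioo (0 : ℝ) 1)
    (x₀ θ₀ : EuclideanSpace ℝ (Fin d)) (c L : ℝ → ℝ) (hc : ∀ ρ, 0 < c ρ) (hL : ∀ ρ, 0 < L ρ) :
    ∃ ρ₁ ρ₂ ρ₃ γ₀ c₀ K₁ κ: ℝ, ∃ k : ℕ, 0 < γ₀ ∧ 0 ≤ K₁ ∧ 0 < κ ∧
      ∀ g : EuclideanSpace ℝ (Fin d) → ℝ,
        QuadBounds g x₀ ρ₁ (c ρ₁) (L ρ₁) → QuadBounds g x₀ ρ₂ (c ρ₂) (L ρ₂) →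
        QuadBounds g x₀ ρ₃ (c ρ₃) (L ρ₃) → ‖gradient g x₀‖ ≤ γ₀ →
        ∀ cG cE b : ℕ, 0 < cE →
          ‖(descentLoop g cG cE 0 β θ₀ (gradient g θ₀) (g θ₀) b).1 - x₀‖ ^ 2 ≤
            4 / c₀ ^ 2 * ‖gradient g x₀‖ ^ 2 +
              K₁ * Real.exp (κ - κ * (b / ((k + 2) * cE + cG : ℕ))) := by
  set R₀ := ‖θ₀ - x₀‖ with hR₀
  have hR₀0 : 0 ≤ R₀ := norm_nonneg _
  -- The order of the choices avoids circularity. The ball of radius `ρ₁` fixes the growth slope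
  -- `γ₀` and the bound `A` on the initial gap; these fix a radius `R` for the sublevel set; the
  -- ball of radius `R + 1` bounds the gradients there by `C`; and `ρ₃ = R + C` contains every trial
  -- point with step at most one. Only then are `k` and the convexity constant read off on the last
  -- ball.
  set ρ₁ := R₀ + 1 with hρ₁
  set γ₀ := c ρ₁ / 4 with hγ₀
  have hγ₀pos : 0 < γ₀ := by have := hc ρ₁; positivity
  set A := γ₀ * R₀ + L ρ₁ / 2 * R₀ ^ 2 with hA
  have hA0 : 0 ≤ A := by have := hL ρ₁; positivity
  set R := R₀ + 1 + A / γ₀ with hR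
  have hAγ : 0 ≤ A / γ₀ := by positivity
  have hR0 : 0 ≤ R := by positivity
  set C := γ₀ * (2 * R + 1) + L (R + 1) / 2 * (R + 1) ^ 2 with hC
  have hC0 : 0 ≤ C := by have := hL (R + 1); positivity
  set ρ₃ := R + C with hρ₃
  have hρ₃0 : 0 ≤ ρ₃ := by positivity
  obtain ⟨k, hk⟩ := exists_pow_lt_of_lt_one (inv_pos.mpr (hL ρ₃)) hβ.2
  have hβk : 0 < β ^ k := pow_pos hβ.1 k
  have hc3 := hc ρ₃
  refine ⟨ρ₁, R + 1, ρ₃, γ₀, c ρ₃, 4 / c ρ₃ * A, β ^ k * c ρ₃, k, hγ₀pos, by positivity,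
    by positivity, ?_⟩
  intro g h1 h2 h3 hγ cG cE b hcE
  have hx₀1 : x₀ ∈ Metric.closedBall x₀ ρ₁ := Metric.mem_closedBall_self (by positivity)
  have hx₀3 : x₀ ∈ Metric.closedBall x₀ ρ₃ := Metric.mem_closedBall_self hρ₃0
  have hgθ₀ : g θ₀ - g x₀ ≤ A := by
    have a := (h1 x₀ hx₀1 θ₀ (by rw [mem_closedBall_iff_norm]; linarith)).2
    have i := abs_le.mp (abs_real_inner_le_norm (gradient g x₀) (θ₀ - x₀))
    have : ‖gradient g x₀‖ * ‖θ₀ - x₀‖ ≤ γ₀ * R₀ := by gcongr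
    linarith [i.2]
  set S := {x | x ∈ Metric.closedBall x₀ R ∧ g x ≤ g θ₀} with hS
  have hS3 : ∀ x ∈ S, x ∈ Metric.closedBall x₀ ρ₃ := fun x hx =>
    Metric.closedBall_subset_closedBall (by linarith) hx.1
  have hstep3 : ∀ x ∈ S, ∀ v ∈ Icc (0 : ℝ) 1,
      x - v • gradient g x ∈ Metric.closedBall x₀ ρ₃ := by
    intro x hx v hv
    have hG := h2.norm_gradient_le hR0 (hc _) (hL _).le hx.1
    have hG' : ‖gradient g x‖ ≤ C := hG.trans (by rw [hC]; gcongr)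
    have hxR := hx.1
    rw [mem_closedBall_iff_norm] at hxR ⊢
    calc ‖x - v • gradient g x - x₀‖ = ‖(x - x₀) - v • gradient g x‖ := by congr 1; abel
      _ ≤ ‖x - x₀‖ + ‖v • gradient g x‖ := norm_sub_le _ _
      _ ≤ R + 1 * C := by
        rw [norm_smul, Real.norm_of_nonneg hv.1]
        gcongr
        exact hv.2
      _ = ρ₃ := by rw [hρ₃, one_mul]
  have hθ₀S : θ₀ ∈ S := by
    refine ⟨?_, le_rfl⟩
    rw [mem_closedBall_iff_norm]
    linarith
  have hstay : ∀ x ∈ S, ∀ v ∈ Icc (0 : ℝ) 1,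
      g (x - v • gradient g x) ≤ g x → x - v • gradient g x ∈ S := by
    -- A trial point is already known to lie within `ρ₃`. If it were farther than `R` from `x₀`,
    -- linear growth with slope `γ₀` would push its value above `g θ₀`, contradicting the decrease.
    intro x hx v hv hle
    refine ⟨?_, hle.trans hx.2⟩
    rw [mem_closedBall_iff_norm]
    by_contra! hcon
    have := h1.linear_growth (by linarith) h3 (hc _) hγ (hstep3 x hx v hv) (by linarith)
    rw [← hγ₀] at this
    have hgx : g x ≤ g θ₀ := hx.2
    have e : γ₀ * R < γ₀ * ‖x - v • gradient g x - x₀‖ := by gcongr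
    have e2 : γ₀ * R = γ₀ * (R₀ + 1) + A := by rw [hR]; field_simp
    have e3 : 0 ≤ γ₀ * (R₀ + 1) := by positivity
    linarith
  have hkS : ∀ x ∈ S, g (x - β ^ k • gradient g x) ≤ g x - β ^ k / 2 * ‖gradient g x‖ ^ 2 := by
    intro x hx
    refine h3.sufficient_decrease (hS3 x hx) hβk.le ?_
      (hstep3 x hx _ ⟨hβk.le, pow_le_one₀ hβ.1.le hβ.2.le⟩)
    have := hL ρ₃
    calc L ρ₃ * β ^ k ≤ L ρ₃ * (L ρ₃)⁻¹ := by gcongr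
      _ = 1 := mul_inv_cancel₀ this.ne'
  obtain ⟨r1, r2⟩ := descentLoop_spec g cG hcE hβ k S (g x₀) (c ρ₃) hc3.le hstay hkS
    (fun x hx => h3.polyak hc3 (hS3 x hx) hx₀3) b θ₀ hθ₀S
  refine (h3.dist_sq_le hρ₃0 hc3 (hS3 _ r1)).trans ?_
  have e1 := (le_max_left _ _).trans r2
  have e2 : max (g θ₀ - g x₀) 0 ≤ A := max_le hgθ₀ hA0
  rw [mul_assoc (4 / c ρ₃) A]
  gcongr
  rw [mul_comm A]
  exact e1.trans (by gcongr)

end GDBLS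

/-! ### Second order Taylor bounds along segments. -/

namespace GDBLS

open scoped RealInnerProductSpace

theorem half_le_of_second_deriv_ge {φ φ' φ'' : ℝ → ℝ} {m : ℝ} (h1 : ∀ s, HasDerivAt φ (φ' s) s)
    (h2 : ∀ s, HasDerivAt φ' (φ'' s) s) (hm : ∀ s ∈ Icc (0 : ℝ) 1, m ≤ φ'' s) :
    m / 2 ≤ φ 1 - φ 0 - φ' 0 := by
  have d1 : ∀ s, HasDerivAt (fun s => φ' s - m * s) (φ'' s - m) s := fun s =>
    ((h2 s).sub ((hasDerivAt_id s).const_mul m)).congr_deriv (by simp)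
  have d2 : ∀ s, HasDerivAt (fun s => φ s - φ' 0 * s - m / 2 * s ^ 2)
      (φ' s - φ' 0 - m * s) s := fun s =>
    (((h1 s).sub ((hasDerivAt_id s).const_mul (φ' 0))).sub
      (((hasDerivAt_id s).pow 2).const_mul (m / 2))).congr_deriv (by simp; ring)
  have m1 : MonotoneOn (fun s => φ' s - m * s) (Icc 0 1) :=
    monotoneOn_of_deriv_nonneg (convex_Icc 0 1)
      (fun s _ => (d1 s).continuousAt.continuousWithinAt)
      (fun s _ => (d1 s).differentiableAt.differentiableWithinAt)
      (fun s hs => by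
        rw [(d1 s).deriv]
        exact sub_nonneg.mpr (hm s (interior_subset hs)))
  have m2 : MonotoneOn (fun s => φ s - φ' 0 * s - m / 2 * s ^ 2) (Icc 0 1) :=
    monotoneOn_of_deriv_nonneg (convex_Icc 0 1)
      (fun s _ => (d2 s).continuousAt.continuousWithinAt)
      (fun s _ => (d2 s).differentiableAt.differentiableWithinAt)
      (fun s hs => by
        rw [(d2 s).deriv]
        have hs' : s ∈ Icc (0 : ℝ) 1 := interior_subset hs
        have := m1 (left_mem_Icc.mpr zero_le_one) hs' hs'.1
        simp only at this
        linarith)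
  have := m2 (left_mem_Icc.mpr zero_le_one) (right_mem_Icc.mpr zero_le_one) zero_le_one
  simp only at this
  linarith

variable {d : ℕ}

theorem contDiff_gradient {g : EuclideanSpace ℝ (Fin d) → ℝ} (hg : ContDiff ℝ 2 g) :
    ContDiff ℝ 1 (gradient g) := by
  have : ContDiff ℝ 1 (fderiv ℝ g) := hg.fderiv_right (by norm_num)
  exact ((InnerProductSpace.toDual ℝ (EuclideanSpace ℝ (Fin d))).symm.contDiff).comp this

theorem hasDerivAt_line {g : EuclideanSpace ℝ (Fin d) → ℝ} (hg : ContDiff ℝ 2 g)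
    (x h : EuclideanSpace ℝ (Fin d)) (s : ℝ) :
    HasDerivAt (fun s : ℝ => g (x + s • h)) ⟪gradient g (x + s • h), h⟫ s := by
  have l : HasDerivAt (fun s : ℝ => x + s • h) h s := by
    simpa using ((hasDerivAt_id s).smul_const h).const_add x
  exact (((hg.differentiable (by norm_num)) (x + s • h)).hasGradientAt.hasFDerivAt.comp_hasDerivAt
    s l).congr_deriv (InnerProductSpace.toDual_apply_apply)

theorem hasDerivAt_inner_gradient_line {g : EuclideanSpace ℝ (Fin d) → ℝ} (hg : ContDiff ℝ 2 g)
    (x h : EuclideanSpace ℝ (Fin d)) (s : ℝ) :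
    HasDerivAt (fun s : ℝ => ⟪gradient g (x + s • h), h⟫)
      ⟪fderiv ℝ (gradient g) (x + s • h) h, h⟫ s := by
  have l : HasDerivAt (fun s : ℝ => x + s • h) h s := by
    simpa using ((hasDerivAt_id s).smul_const h).const_add x
  have := (((contDiff_gradient hg).differentiable (by norm_num))
    (x + s • h)).hasFDerivAt.comp_hasDerivAt s l
  simpa using this.inner ℝ (hasDerivAt_const s h)

theorem taylor_two_lower {g : EuclideanSpace ℝ (Fin d) → ℝ} (hg : ContDiff ℝ 2 g)
    {x h : EuclideanSpace ℝ (Fin d)} {m : ℝ}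
    (hm : ∀ s ∈ Icc (0 : ℝ) 1, m ≤ ⟪fderiv ℝ (gradient g) (x + s • h) h, h⟫) :
    m / 2 ≤ g (x + h) - g x - ⟪gradient g x, h⟫ := by
  simpa using half_le_of_second_deriv_ge (hasDerivAt_line hg x h)
    (hasDerivAt_inner_gradient_line hg x h) hm

theorem taylor_two_upper {g : EuclideanSpace ℝ (Fin d) → ℝ} (hg : ContDiff ℝ 2 g)
    {x h : EuclideanSpace ℝ (Fin d)} {m : ℝ}
    (hm : ∀ s ∈ Icc (0 : ℝ) 1, ⟪fderiv ℝ (gradient g) (x + s • h) h, h⟫ ≤ m) :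
    g (x + h) - g x - ⟪gradient g x, h⟫ ≤ m / 2 := by
  have := half_le_of_second_deriv_ge (fun s => (hasDerivAt_line hg x h s).neg)
    (fun s => (hasDerivAt_inner_gradient_line hg x h s).neg)
    (fun s hs => neg_le_neg (hm s hs))
  simp only [Pi.neg_apply, zero_smul, one_smul, add_zero] at this
  linarith

theorem QuadBounds.of_hessian {g : EuclideanSpace ℝ (Fin d) → ℝ} (hg : ContDiff ℝ 2 g)
    {x₀ : EuclideanSpace ℝ (Fin d)} {ρ c L : ℝ}
    (h : ∀ x ∈ Metric.closedBall x₀ ρ, ∀ u, c * ‖u‖ ^ 2 ≤ ⟪fderiv ℝ (gradient g) x u, u⟫ ∧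
      ⟪fderiv ℝ (gradient g) x u, u⟫ ≤ L * ‖u‖ ^ 2) : QuadBounds g x₀ ρ c L := by
  intro x hx y hy
  have hseg : ∀ s ∈ Icc (0 : ℝ) 1, x + s • (y - x) ∈ Metric.closedBall x₀ ρ := fun s hs =>
    (convex_closedBall x₀ ρ).add_smul_sub_mem hx hy hs
  have h1 := taylor_two_lower hg (fun s hs => (h _ (hseg s hs) (y - x)).1)
  have h2 := taylor_two_upper hg (fun s hs => (h _ (hseg s hs) (y - x)).2)
  rw [add_sub_cancel] at h1 h2
  constructor <;> linarith

theorem abs_inner_apply_le (T : EuclideanSpace ℝ (Fin d) →L[ℝ] EuclideanSpace ℝ (Fin d))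
    (u : EuclideanSpace ℝ (Fin d)) : |⟪T u, u⟫| ≤ ‖T‖ * ‖u‖ ^ 2 :=
  calc |⟪T u, u⟫| ≤ ‖T u‖ * ‖u‖ := abs_real_inner_le_norm _ _
    _ ≤ ‖T‖ * ‖u‖ * ‖u‖ := by gcongr; exact T.le_opNorm u
    _ = ‖T‖ * ‖u‖ ^ 2 := by ring

/-- The constant `M / 2` is not sharp; only the cubic order matters, since the estimate is used for
steps tending to zero. -/
theorem abs_taylor_two_le {g : EuclideanSpace ℝ (Fin d) → ℝ} (hg : ContDiff ℝ 2 g)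
    {x h : EuclideanSpace ℝ (Fin d)} {M : ℝ} (hM : 0 ≤ M)
    (hLip : ∀ y ∈ Metric.closedBall x ‖h‖,
      ‖fderiv ℝ (gradient g) y - fderiv ℝ (gradient g) x‖ ≤ M * ‖y - x‖) :
    |g (x + h) - g x - ⟪gradient g x, h⟫ - ⟪fderiv ℝ (gradient g) x h, h⟫ / 2|
      ≤ M / 2 * ‖h‖ ^ 3 := by
  have key : ∀ s ∈ Icc (0 : ℝ) 1, |⟪fderiv ℝ (gradient g) (x + s • h) h, h⟫ -
      ⟪fderiv ℝ (gradient g) x h, h⟫| ≤ M * ‖h‖ ^ 3 := by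
    intro s hs
    have hn : ‖x + s • h - x‖ ≤ ‖h‖ := by
      rw [add_sub_cancel_left, norm_smul, Real.norm_of_nonneg hs.1]
      exact mul_le_of_le_one_left (norm_nonneg _) hs.2
    have := hLip (x + s • h) (by rwa [mem_closedBall_iff_norm])
    rw [← inner_sub_left, ← sub_apply]
    calc _ ≤ _ := abs_inner_apply_le _ _
      _ ≤ M * ‖h‖ * ‖h‖ ^ 2 := by
        gcongr
        exact this.trans (by gcongr)
      _ = M * ‖h‖ ^ 3 := by ring
  have h1 := taylor_two_lower hg (m := ⟪fderiv ℝ (gradient g) x h, h⟫ - M * ‖h‖ ^ 3)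
    (fun s hs => by linarith [(abs_le.mp (key s hs)).1])
  have h2 := taylor_two_upper hg (m := ⟪fderiv ℝ (gradient g) x h, h⟫ + M * ‖h‖ ^ 3)
    (fun s hs => by linarith [(abs_le.mp (key s hs)).2])
  rw [abs_le]
  constructor <;> linarith

end GDBLS

/-! ### Measurability of gradients and Hessians in the sample variable. -/

namespace GDBLS

open scoped RealInnerProductSpace

section Measurability

variable {d : ℕ} {𝒵 : Type*} [MeasurableSpace 𝒵]

theorem measurable_fderiv_apply_of_forall {V : Type*} [NormedAddCommGroup V] [NormedSpace ℝ V]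
    [MeasurableSpace V] [BorelSpace V] [SecondCountableTopology V]
    {F : EuclideanSpace ℝ (Fin d) → 𝒵 → V} (hF : ∀ x, Measurable (F x))
    (x v : EuclideanSpace ℝ (Fin d)) (hd : ∀ z, DifferentiableAt ℝ (fun y => F y z) x) :
    Measurable (fun z => fderiv ℝ (fun y => F y z) x v) := by
  refine measurable_of_tendsto_metrizable
    (f := fun (k : ℕ) z => (k : ℝ) • (F (x + (k : ℝ)⁻¹ • v) z - F x z)) ?_ ?_
  · intro k
    exact ((hF _).sub (hF _)).const_smul _
  · rw [tendsto_pi_nhds]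
    intro z
    refine (hd z).hasFDerivAt.lim v (c := fun k : ℕ => (k : ℝ)) ?_
    simpa using tendsto_natCast_atTop_atTop (R := ℝ)

/-- In finite dimension an operator is a continuous function of its values on a basis. -/
theorem measurable_clm_of_apply {V : Type*} [NormedAddCommGroup V] [NormedSpace ℝ V]
    [MeasurableSpace V] [BorelSpace V] [SecondCountableTopology V]
    {T : 𝒵 → EuclideanSpace ℝ (Fin d) →L[ℝ] V} (hT : ∀ v, Measurable (fun z => T z v)) :
    Measurable T := by
  let b := EuclideanSpace.basisFun (Fin d) ℝ
  let Φ : (Fin d → V) → EuclideanSpace ℝ (Fin d) →L[ℝ] V := fun w =>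
    ∑ k, ContinuousLinearMap.smulRightL ℝ (EuclideanSpace ℝ (Fin d)) V (innerSL ℝ (b k)) (w k)
  have hΦ : Continuous Φ := by fun_prop
  have : T = fun z => Φ (fun k => T z (b k)) := by
    funext z
    ext1 x
    conv_lhs => rw [← b.sum_repr' x]
    simp [Φ]
  rw [this]
  exact hΦ.measurable.comp (measurable_pi_lambda _ fun k => hT (b k))

theorem measurable_grad {f : EuclideanSpace ℝ (Fin d) → 𝒵 → ℝ} (hf : ∀ x, Measurable (f x))
    (hd : ∀ z, ContDiff ℝ 2 (fun θ => f θ z)) (θ : EuclideanSpace ℝ (Fin d)) :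
    Measurable (grad f θ) :=
  (InnerProductSpace.toDual ℝ (EuclideanSpace ℝ (Fin d))).symm.continuous.measurable.comp
    (measurable_clm_of_apply fun v => measurable_fderiv_apply_of_forall hf θ v
      fun z => (hd z).differentiable (by norm_num) θ)

theorem measurable_hess {f : EuclideanSpace ℝ (Fin d) → 𝒵 → ℝ} (hf : ∀ x, Measurable (f x))
    (hd : ∀ z, ContDiff ℝ 2 (fun θ => f θ z)) (θ : EuclideanSpace ℝ (Fin d)) :
    Measurable (hess f θ) :=
  measurable_clm_of_apply fun v => measurable_fderiv_apply_of_forall (measurable_grad hf hd) θ v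
    fun z => (contDiff_gradient (hd z)).differentiable (by norm_num) θ

omit [MeasurableSpace 𝒵] in
theorem continuous_hess {f : EuclideanSpace ℝ (Fin d) → 𝒵 → ℝ}
    (hd : ∀ z, ContDiff ℝ 2 (fun θ => f θ z)) (z : 𝒵) : Continuous (fun θ => hess f θ z) :=
  (contDiff_gradient (hd z)).continuous_fderiv (by norm_num)

/-- Continuity of the Hessian reduces the condition to a countable dense subset. Measurability is
needed to transfer the almost sure property from `Z` to each `Zs i` by equality in law. -/
theorem measurableSet_hess_lipschitz {f : EuclideanSpace ℝ (Fin d) → 𝒵 → ℝ}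
    (hf : ∀ x, Measurable (f x)) (hd : ∀ z, ContDiff ℝ 2 (fun θ => f θ z)) {M : 𝒵 → ℝ}
    (hM : Measurable M) (Θ : Set (EuclideanSpace ℝ (Fin d))) :
    MeasurableSet {z | ∀ θ ∈ Θ, ∀ θ' ∈ Θ, ‖hess f θ z - hess f θ' z‖ ≤ M z * ‖θ - θ'‖} := by
  obtain ⟨t, htΘ, htc, hΘt⟩ :=
    (TopologicalSpace.IsSeparable.of_separableSpace Θ).exists_countable_dense_subset
  have : {z | ∀ θ ∈ Θ, ∀ θ' ∈ Θ, ‖hess f θ z - hess f θ' z‖ ≤ M z * ‖θ - θ'‖} =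
      ⋂ θ ∈ t, ⋂ θ' ∈ t, {z | ‖hess f θ z - hess f θ' z‖ ≤ M z * ‖θ - θ'‖} := by
    ext z
    simp only [mem_ofPred_eq, mem_iInter]
    refine ⟨fun h θ hθ θ' hθ' => h θ (htΘ hθ) θ' (htΘ hθ'), fun h θ hθ θ' hθ' => ?_⟩
    have hc := continuous_hess hd z
    have hcl : IsClosed {p : EuclideanSpace ℝ (Fin d) × EuclideanSpace ℝ (Fin d) |
        ‖hess f p.1 z - hess f p.2 z‖ ≤ M z * ‖p.1 - p.2‖} :=
      isClosed_le ((hc.comp continuous_fst).sub (hc.comp continuous_snd)).norm (by fun_prop)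
    have hsub : t ×ˢ t ⊆ {p : EuclideanSpace ℝ (Fin d) × EuclideanSpace ℝ (Fin d) |
        ‖hess f p.1 z - hess f p.2 z‖ ≤ M z * ‖p.1 - p.2‖} := fun p hp => h _ hp.1 _ hp.2
    have := closure_minimal hsub hcl
    rw [closure_prod_eq] at this
    have hmem : (θ, θ') ∈ closure t ×ˢ closure t := ⟨hΘt hθ, hΘt hθ'⟩
    simpa only [mem_ofPred_eq] using this hmem
  rw [this]
  refine MeasurableSet.biInter htc fun θ _ => MeasurableSet.biInter htc fun θ' _ => ?_
  exact measurableSet_le ((measurable_hess hf hd θ).sub (measurable_hess hf hd θ')).norm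
    (hM.mul_const _)

end Measurability

/-! ### First and second order information on the population objective. -/

section Population

variable {d : ℕ} {Ω 𝒵 : Type*} [MeasurableSpace Ω] [MeasurableSpace 𝒵] {P : Measure Ω}
  {Z : Ω → 𝒵} {f : EuclideanSpace ℝ (Fin d) → 𝒵 → ℝ} {θs : EuclideanSpace ℝ (Fin d)} {α : ℝ}

theorem SmoothMoment.integrable_grad [IsProbabilityMeasure P] (h : SmoothMoment P Z f θs α)
    (hα : 0 ≤ α) (hf : ∀ x, Measurable (f x)) (hZ : Measurable Z) :
    Integrable (fun ω => grad f θs (Z ω)) P := by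
  refine ((integrable_const (1 : ℝ)).add h.grad_integrable).mono'
    ((measurable_grad hf h.contDiff θs).comp hZ).aestronglyMeasurable (ae_of_all _ fun ω => ?_)
  simp only [Pi.add_apply]
  rcases le_total ‖grad f θs (Z ω)‖ 1 with h1 | h1
  · have : 0 ≤ ‖grad f θs (Z ω)‖ ^ (1 + α) := by positivity
    linarith
  · have := Real.rpow_le_rpow_of_exponent_le h1 (show (1 : ℝ) ≤ 1 + α by linarith)
    rw [Real.rpow_one] at this
    linarith

theorem SmoothMoment.integrable_hess (h : SmoothMoment P Z f θs α)
    (hf : ∀ x, Measurable (f x)) (hZ : Measurable Z) (x : EuclideanSpace ℝ (Fin d)) :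
    Integrable (fun ω => hess f x (Z ω)) P := by
  obtain ⟨M, -, -, hMi, hM⟩ := h.hess_lipschitz {x, θs} (toFinite _).isCompact
  refine (h.hess_integrable.add (hMi.mul_const ‖x - θs‖)).mono'
    ((measurable_hess hf h.contDiff x).comp hZ).aestronglyMeasurable ?_
  filter_upwards [hM] with ω hω
  have h1 := hω x (by simp) θs (by simp)
  have h2 := norm_le_norm_add_norm_sub' (hess f x (Z ω)) (hess f θs (Z ω))
  simp only [Pi.add_apply]
  linarith

theorem nonneg_of_forall_small {a b : ℝ} {δ : ℝ} (hδ : 0 < δ)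
    (h : ∀ t ∈ Ioc 0 δ, 0 ≤ a + t * b) : 0 ≤ a := by
  have : Tendsto (fun t : ℝ => a + t * b) (𝓝[>] 0) (𝓝 (a + 0 * b)) :=
    (Continuous.tendsto (by fun_prop) 0).mono_left nhdsWithin_le_nhds
  rw [zero_mul, add_zero] at this
  refine ge_of_tendsto this ?_
  filter_upwards [Ioc_mem_nhdsGT hδ] with t ht using h t ht

/-- No differentiation under the integral is used. Integrating the pointwise Taylor bound in the
direction `u = -G` gives `0 ≤ F(θs + t u) - F(θs) ≤ t ⟪G, u⟫ + O(t²)`; dividing by `t` and letting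
`t → 0` gives `0 ≤ -‖G‖²`. -/
theorem SmoothMoment.integral_grad_eq_zero [IsProbabilityMeasure P] (h : SmoothMoment P Z f θs α)
    (hα : 0 ≤ α) (hf : ∀ x, Measurable (f x)) (hZ : Measurable Z)
    (hint : ∀ θ, Integrable (fun ω => f θ (Z ω)) P)
    (hmin : ∀ θ, objective P Z f θs ≤ objective P Z f θ) :
    ∫ ω, grad f θs (Z ω) ∂P = 0 := by
  have hgi := h.integrable_grad hα hf hZ
  have hhi := h.integrable_hess hf hZ θs
  obtain ⟨M, -, hM0, hMi, hM⟩ :=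
    h.hess_lipschitz (Metric.closedBall θs 1) (isCompact_closedBall _ _)
  set G := ∫ ω, grad f θs (Z ω) ∂P with hG
  set H := ∫ ω, hess f θs (Z ω) ∂P with hH
  suffices hle : 0 ≤ ⟪G, -G⟫ by
    rw [inner_neg_right, real_inner_self_eq_norm_sq] at hle
    have : ‖G‖ ^ 2 = 0 := le_antisymm (by linarith) (by positivity)
    simpa using this
  set u := -G
  refine nonneg_of_forall_small (δ := 1 / (‖u‖ + 1)) (b := ‖H‖ / 2 * ‖u‖ ^ 2 +
    (∫ ω, M (Z ω) ∂P) / 2 * ‖u‖ ^ 3) (by positivity) ?_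
  rintro t ⟨ht0, ht1⟩
  have htu : ‖t • u‖ ≤ 1 := by
    rw [norm_smul, Real.norm_of_nonneg ht0.le]
    rw [le_div_iff₀ (by positivity)] at ht1
    linarith
  have ht11 : t ≤ 1 := ht1.trans (by
    rw [div_le_one (by positivity)]; linarith [norm_nonneg u])
  have hpt : ∀ᵐ ω ∂P, f (θs + t • u) (Z ω) - f θs (Z ω) ≤
      ⟪grad f θs (Z ω), t • u⟫ + ⟪hess f θs (Z ω) (t • u), t • u⟫ / 2
        + M (Z ω) * (‖t • u‖ ^ 3 / 2) := by
    filter_upwards [hM] with ω hω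
    have := abs_taylor_two_le (h.contDiff (Z ω)) (x := θs) (h := t • u) (hM0 (Z ω))
      (fun y hy => hω y (Metric.closedBall_subset_closedBall htu hy) θs
        (Metric.mem_closedBall_self zero_le_one))
    have := (abs_le.mp this).2
    simp only [grad, hess]
    linarith
  have i1 : Integrable (fun ω => ⟪grad f θs (Z ω), t • u⟫) P := hgi.inner_const _
  have i2 : Integrable (fun ω => ⟪hess f θs (Z ω) (t • u), t • u⟫ / 2) P :=
    ((hhi.apply_continuousLinearMap (t • u)).inner_const _).div_const 2
  have i3 : Integrable (fun ω => M (Z ω) * (‖t • u‖ ^ 3 / 2)) P := hMi.mul_const _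
  have hI := integral_mono_ae ((hint (θs + t • u)).sub (hint θs)) ((i1.add i2).add i3) hpt
  have e1 : ∫ ω, ⟪grad f θs (Z ω), t • u⟫ ∂P = ⟪G, t • u⟫ := by
    rw [hG, real_inner_comm, ← integral_inner hgi]
    simp_rw [real_inner_comm]
  have e2 : ∫ ω, ⟪hess f θs (Z ω) (t • u), t • u⟫ ∂P = ⟪H (t • u), t • u⟫ := by
    rw [hH, ContinuousLinearMap.integral_apply hhi, real_inner_comm,
      ← integral_inner (hhi.apply_continuousLinearMap (t • u))]
    simp_rw [real_inner_comm]
  rw [integral_sub' (hint _) (hint _), integral_add' (i1.add i2) i3, integral_add' i1 i2,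
    integral_div, integral_mul_const, e1, e2] at hI
  have hm := hmin (θs + t • u)
  have a := (abs_le.mp (abs_inner_apply_le H (t • u))).2
  simp only [objective] at hm
  rw [inner_smul_right] at hI
  rw [norm_smul, Real.norm_of_nonneg ht0.le] at hI a
  have hM0' : 0 ≤ ∫ ω, M (Z ω) ∂P := integral_nonneg fun ω => hM0 _
  have hfin : 0 ≤ t * ⟪G, u⟫ + ‖H‖ * (t * ‖u‖) ^ 2 / 2 +
      (∫ ω, M (Z ω) ∂P) * ((t * ‖u‖) ^ 3 / 2) := by linarith
  have h3 : t ^ 3 ≤ t ^ 2 := pow_le_pow_of_le_one ht0.le ht11 (by norm_num)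
  have h4 : (∫ ω, M (Z ω) ∂P) * ((t * ‖u‖) ^ 3 / 2) ≤
      (∫ ω, M (Z ω) ∂P) * (t ^ 2 * ‖u‖ ^ 3 / 2) := by
    rw [mul_pow]; gcongr
  have h5 : 0 ≤ t * (⟪G, u⟫ + t * (‖H‖ / 2 * ‖u‖ ^ 2 +
      (∫ ω, M (Z ω) ∂P) / 2 * ‖u‖ ^ 3)) := by
    linarith
  exact nonneg_of_mul_nonneg_right h5 ht0

/-- Local strong convexity gives a lower bound on the expected Hessian. -/
theorem SmoothMoment.exists_hess_lower [IsProbabilityMeasure P] (h : SmoothMoment P Z f θs α)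
    (hf : ∀ x, Measurable (f x)) (hZ : Measurable Z)
    (hint : ∀ θ, Integrable (fun ω => f θ (Z ω)) P)
    (hsc : LocallyStronglyConvex (objective P Z f)) (ρ : ℝ) :
    ∃ c : ℝ, 0 < c ∧ ∀ x ∈ Metric.closedBall θs ρ, ∀ u,
      c * ‖u‖ ^ 2 ≤ ⟪(∫ ω, hess f x (Z ω) ∂P) u, u⟫ := by
  obtain ⟨c, hc, hconv⟩ := hsc (Metric.closedBall θs (ρ + 1)) (isCompact_closedBall _ _)
  obtain ⟨M, -, hM0, hMi, hM⟩ :=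
    h.hess_lipschitz (Metric.closedBall θs (ρ + 1)) (isCompact_closedBall _ _)
  refine ⟨c, hc, fun x hx u => ?_⟩
  have hhi := h.integrable_hess hf hZ x
  set H := ∫ ω, hess f x (Z ω) ∂P with hH
  rw [← sub_nonneg]
  refine nonneg_of_forall_small (δ := 1 / (‖u‖ + 1)) (b := (∫ ω, M (Z ω) ∂P) * ‖u‖ ^ 3)
    (by positivity) ?_
  rintro t ⟨ht0, ht1⟩
  have htu : ‖t • u‖ ≤ 1 := by
    rw [norm_smul, Real.norm_of_nonneg ht0.le]
    rw [le_div_iff₀ (by positivity)] at ht1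
    linarith
  have hball : ∀ w : EuclideanSpace ℝ (Fin d), ‖w‖ ≤ 1 →
      Metric.closedBall x ‖w‖ ⊆ Metric.closedBall θs (ρ + 1) := fun w hw =>
    Metric.closedBall_subset_closedBall' (by
      have := Metric.mem_closedBall.mp hx
      linarith)
  have hpt : ∀ w : EuclideanSpace ℝ (Fin d), ‖w‖ ≤ 1 → ∀ᵐ ω ∂P, f (x + w) (Z ω) - f x (Z ω) -
      ⟪grad f x (Z ω), w⟫ ≤ ⟪hess f x (Z ω) w, w⟫ / 2 + M (Z ω) * (‖w‖ ^ 3 / 2) := by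
    intro w hw
    filter_upwards [hM] with ω hω
    have := abs_taylor_two_le (h.contDiff (Z ω)) (x := x) (h := w) (hM0 (Z ω))
      (fun y hy => hω y (hball w hw hy) x
        (hball w hw (Metric.mem_closedBall_self (norm_nonneg _))))
    have := (abs_le.mp this).2
    simp only [grad, hess]
    linarith
  -- In the symmetric second difference the gradient at `x` cancels, so its integrability is not
  -- needed. A1 at `a = 1 / 2` bounds the expected difference below by `c t² ‖u‖²`; dividing by `t²`
  -- and letting `t → 0` gives the claim.
  have hpt2 : ∀ᵐ ω ∂P, f (x + t • u) (Z ω) + f (x + -(t • u)) (Z ω) - 2 * f x (Z ω) ≤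
      ⟪hess f x (Z ω) (t • u), t • u⟫ + M (Z ω) * ‖t • u‖ ^ 3 := by
    filter_upwards [hpt (t • u) htu, hpt (-(t • u)) (by rwa [norm_neg])] with ω h1 h2
    simp only [map_neg, inner_neg_neg, norm_neg] at h2
    rw [inner_neg_right] at h2
    linarith
  have i1 : Integrable (fun ω => ⟪hess f x (Z ω) (t • u), t • u⟫) P :=
    ((hhi.apply_continuousLinearMap (t • u)).inner_const _)
  have i2 : Integrable (fun ω => M (Z ω) * ‖t • u‖ ^ 3) P := hMi.mul_const _
  have hI := integral_mono_ae (((hint (x + t • u)).add (hint (x + -(t • u)))).sub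
    ((hint x).const_mul 2)) (i1.add i2) hpt2
  have e2 : ∫ ω, ⟪hess f x (Z ω) (t • u), t • u⟫ ∂P = ⟪H (t • u), t • u⟫ := by
    rw [hH, ContinuousLinearMap.integral_apply hhi, real_inner_comm,
      ← integral_inner (hhi.apply_continuousLinearMap (t • u))]
    simp_rw [real_inner_comm]
  rw [integral_sub' ((hint _).add (hint _)) ((hint _).const_mul 2), integral_add' (hint _) (hint _),
    integral_const_mul, integral_add' i1 i2, integral_mul_const, e2] at hI
  have hmem : ∀ w : EuclideanSpace ℝ (Fin d), ‖w‖ ≤ 1 → x + w ∈ Metric.closedBall θs (ρ + 1) :=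
    fun w hw => hball w hw (by simp)
  have hcv := hconv (1 / 2) (by norm_num) _ (hmem (t • u) htu) _
    (hmem (-(t • u)) (by rwa [norm_neg]))
  have s1 : (1 / 2 : ℝ) • (x + t • u) + (1 - 1 / 2 : ℝ) • (x + -(t • u)) = x := by module
  have s2 : x + t • u - (x + -(t • u)) = (2 * t) • u := by module
  rw [s1, s2, norm_smul, Real.norm_of_nonneg (by positivity)] at hcv
  simp only [objective] at hcv
  rw [norm_smul, Real.norm_of_nonneg ht0.le, map_smul, inner_smul_left, inner_smul_right] at hI
  simp only [conj_trivial] at hI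
  have h5 : 0 ≤ t ^ 2 * (⟪H u, u⟫ - c * ‖u‖ ^ 2 + t * ((∫ ω, M (Z ω) ∂P) * ‖u‖ ^ 3)) := by
    nlinarith
  exact nonneg_of_mul_nonneg_right h5 (by positivity)

end Population

end GDBLS

namespace GDBLS

open scoped RealInnerProductSpace

/-! ### Derivatives of the sample average. -/

section Sample

variable {d : ℕ} {𝒵 : Type*} {f : EuclideanSpace ℝ (Fin d) → 𝒵 → ℝ}

theorem sampleAverage_contDiff (hd : ∀ z, ContDiff ℝ 2 (fun θ => f θ z)) (zs : ℕ → 𝒵) (n : ℕ) :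
    ContDiff ℝ 2 (sampleAverage f zs n) :=
  contDiff_const.mul (ContDiff.sum fun i _ => hd (zs i))

theorem gradient_sampleAverage (hd : ∀ z, ContDiff ℝ 2 (fun θ => f θ z)) (zs : ℕ → 𝒵) (n : ℕ)
    (x : EuclideanSpace ℝ (Fin d)) : gradient (sampleAverage f zs n) x =
      (n : ℝ)⁻¹ • ∑ i ∈ Finset.range n, grad f x (zs i) := by
  have h : HasFDerivAt (sampleAverage f zs n)
      ((n : ℝ)⁻¹ • ∑ i ∈ Finset.range n, fderiv ℝ (fun θ => f θ (zs i)) x) x := by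
    have e : sampleAverage f zs n =
        (n : ℝ)⁻¹ • fun y => ∑ i ∈ Finset.range n, f y (zs i) := by
      funext y
      simp [sampleAverage]
    rw [e]
    exact (HasFDerivAt.fun_sum (u := Finset.range n) fun i _ =>
      ((hd (zs i)).differentiable (by norm_num) x).hasFDerivAt).const_smul ((n : ℝ)⁻¹)
  rw [gradient, h.fderiv]
  simp [grad, gradient]

theorem fderiv_gradient_sampleAverage (hd : ∀ z, ContDiff ℝ 2 (fun θ => f θ z)) (zs : ℕ → 𝒵)
    (n : ℕ) (x : EuclideanSpace ℝ (Fin d)) : fderiv ℝ (gradient (sampleAverage f zs n)) x =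
      (n : ℝ)⁻¹ • ∑ i ∈ Finset.range n, hess f x (zs i) := by
  have h := (HasFDerivAt.fun_sum (u := Finset.range n) (x := x) fun i _ =>
    (((contDiff_gradient (hd (zs i))).differentiable (by norm_num)) x).hasFDerivAt).const_smul
      ((n : ℝ)⁻¹)
  have e : gradient (sampleAverage f zs n) =
      (n : ℝ)⁻¹ • fun y => ∑ i ∈ Finset.range n, gradient (fun θ => f θ (zs i)) y :=
    funext fun y => gradient_sampleAverage hd zs n y
  rw [e]
  exact h.fderiv

theorem norm_average_sub_le {V : Type*} [NormedAddCommGroup V] [NormedSpace ℝ V] {a b : ℕ → V}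
    {M : ℕ → ℝ} {r : ℝ} (h : ∀ i, ‖a i - b i‖ ≤ M i * r) (n : ℕ) :
    ‖(n : ℝ)⁻¹ • ∑ i ∈ Finset.range n, a i - (n : ℝ)⁻¹ • ∑ i ∈ Finset.range n, b i‖ ≤
      (n : ℝ)⁻¹ • (∑ i ∈ Finset.range n, M i) * r := by
  rw [← smul_sub, ← Finset.sum_sub_distrib, norm_smul, Real.norm_of_nonneg (by positivity),
    smul_eq_mul, mul_assoc, Finset.sum_mul]
  gcongr
  exact (norm_sum_le _ _).trans (Finset.sum_le_sum fun i _ => h i)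

end Sample

/-! ### Quadratic bounds for the sample average, from the strong law. -/

section Probability

variable {Ω : Type*} [MeasurableSpace Ω] {P : Measure Ω}

theorem tendsto_measure_compl_of_ae_eventually [IsFiniteMeasure P] {E : ℕ → Set Ω}
    (hE : ∀ n, MeasurableSet (E n)) (h : ∀ᵐ ω ∂P, ∀ᶠ n in atTop, ω ∈ E n) :
    Tendsto (fun n => P (E n)ᶜ) atTop (𝓝 0) := by
  have := tendsto_measure_of_ae_tendsto_indicator_of_isFiniteMeasure (μ := P) atTop
    MeasurableSet.empty (fun n => (hE n).compl) (by
      filter_upwards [h] with ω hω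
      filter_upwards [hω] with n hn
      simp [hn])
  simpa using this

variable {d : ℕ} {𝒵 : Type*} [MeasurableSpace 𝒵]
  {Z : Ω → 𝒵} {f : EuclideanSpace ℝ (Fin d) → 𝒵 → ℝ} {θs : EuclideanSpace ℝ (Fin d)} {α : ℝ}

theorem strong_law_comp [IsProbabilityMeasure P] {Zs : ℕ → Ω → 𝒵} (hindep : iIndepFun Zs P)
    (hident : ∀ i, IdentDistrib (Zs i) Z P P) {V : Type*} [NormedAddCommGroup V]
    [NormedSpace ℝ V] [CompleteSpace V] [MeasurableSpace V] [BorelSpace V] {g : 𝒵 → V}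
    (hg : Measurable g) (hgi : Integrable (fun ω => g (Z ω)) P) :
    ∀ᵐ ω ∂P, Tendsto (fun n : ℕ => (n : ℝ)⁻¹ • ∑ i ∈ Finset.range n, g (Zs i ω)) atTop
      (𝓝 (∫ ω, g (Z ω) ∂P)) := by
  have hid : ∀ i, IdentDistrib (fun ω => g (Zs i ω)) (fun ω => g (Z ω)) P P :=
    fun i => (hident i).comp hg
  have := strong_law_ae (μ := P) (fun i ω => g (Zs i ω)) ((hid 0).symm.integrable_snd hgi)
    (fun i j hij => (hindep.indepFun hij).comp hg hg) (fun i => (hid i).trans (hid 0).symm)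
  rwa [(hid 0).integral_eq] at this

omit P in
theorem measurable_average {Zs : ℕ → Ω → 𝒵} (hZs : ∀ i, Measurable (Zs i)) {V : Type*}
    [NormedAddCommGroup V] [NormedSpace ℝ V] [MeasurableSpace V] [BorelSpace V]
    [SecondCountableTopology V] {g : 𝒵 → V} (hg : Measurable g) (n : ℕ) :
    Measurable (fun ω => (n : ℝ)⁻¹ • ∑ i ∈ Finset.range n, g (Zs i ω)) := by
  have : Measurable (fun ω => ∑ i ∈ Finset.range n, g (Zs i ω)) :=
    Finset.measurable_fun_sum _ fun i _ => hg.comp (hZs i)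
  exact this.const_smul ((n : ℝ)⁻¹)

/-- With probability tending to one, the sample average is strongly convex and smooth on a given
ball. -/
theorem SmoothMoment.exists_quadBounds [IsProbabilityMeasure P] (h : SmoothMoment P Z f θs α)
    (hf : ∀ x, Measurable (f x)) (hZ : Measurable Z) {Zs : ℕ → Ω → 𝒵}
    (hZs : ∀ i, Measurable (Zs i)) (hindep : iIndepFun Zs P)
    (hident : ∀ i, IdentDistrib (Zs i) Z P P) (hint : ∀ θ, Integrable (fun ω => f θ (Z ω)) P)
    (hsc : LocallyStronglyConvex (objective P Z f)) (ρ : ℝ) :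
    ∃ c L : ℝ, 0 < c ∧ 0 < L ∧ Tendsto (fun n => P {ω | ¬ QuadBounds
      (sampleAverage f (fun i => Zs i ω) n) θs ρ c L}) atTop (𝓝 0) := by
  obtain ⟨c, hc, hH⟩ := h.exists_hess_lower hf hZ hint hsc ρ
  obtain ⟨M, hMm, hM0, hMi, hM⟩ :=
    h.hess_lipschitz (Metric.closedBall θs ρ) (isCompact_closedBall _ _)
  set H := fun x => ∫ ω, hess f x (Z ω) ∂P with hHdef
  set m := ∫ ω, M (Z ω) ∂P with hm
  have hm0 : 0 ≤ m := integral_nonneg fun ω => hM0 _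
  -- The mesh is chosen so that, once the averaged Lipschitz constant is below `m + 1`, moving to a
  -- net point costs at most `c / 4`. The strong law at the net point costs another `c / 4`, which
  -- leaves `c / 2` of the lower bound `c`.
  set η := c / (4 * (m + 1)) with hη
  obtain ⟨t, htsub, htfin, hcover⟩ :=
    (isCompact_closedBall θs ρ).finite_cover_balls (e := η) (by positivity)
  obtain ⟨K, hK⟩ : ∃ K : ℝ, ∀ x ∈ t, ‖H x‖ ≤ K :=
    (htfin.image fun x => ‖H x‖).bddAbove.imp fun K hK x hx => hK (mem_image_of_mem _ hx)
  have hLip : ∀ᵐ ω ∂P, ∀ i, ∀ θ ∈ Metric.closedBall θs ρ, ∀ θ' ∈ Metric.closedBall θs ρ,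
      ‖hess f θ (Zs i ω) - hess f θ' (Zs i ω)‖ ≤ M (Zs i ω) * ‖θ - θ'‖ :=
    ae_all_iff.mpr fun i => (hident i).symm.ae_snd
      (measurableSet_hess_lipschitz hf h.contDiff hMm _) hM
  set E : ℕ → Set Ω := fun n =>
    {ω | (n : ℝ)⁻¹ • ∑ i ∈ Finset.range n, M (Zs i ω) < m + 1} ∩
      ⋂ x ∈ t, {ω | ‖(n : ℝ)⁻¹ • ∑ i ∈ Finset.range n, hess f x (Zs i ω) - H x‖ < c / 4} with hE
  have hEm : ∀ n, MeasurableSet (E n) := by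
    intro n
    refine MeasurableSet.inter ?_ (MeasurableSet.biInter htfin.countable fun x _ => ?_)
    · exact measurableSet_lt (measurable_average hZs hMm n) measurable_const
    · have := measurable_average hZs (measurable_hess hf h.contDiff x) n
      exact measurableSet_lt (this.sub_const (H x)).norm measurable_const
  have hEev : ∀ᵐ ω ∂P, ∀ᶠ n in atTop, ω ∈ E n := by
    have h1 := strong_law_comp hindep hident hMm hMi
    have h2 : ∀ᵐ ω ∂P, ∀ x ∈ t, Tendsto (fun n : ℕ =>
        (n : ℝ)⁻¹ • ∑ i ∈ Finset.range n, hess f x (Zs i ω)) atTop (𝓝 (H x)) :=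
      (ae_ball_iff htfin.countable).mpr fun x _ =>
        strong_law_comp hindep hident (measurable_hess hf h.contDiff x) (h.integrable_hess hf hZ x)
    filter_upwards [h1, h2] with ω hω1 hω2
    have a1 := hω1.eventually (Iio_mem_nhds (show m < m + 1 by linarith))
    have a2 : ∀ᶠ n : ℕ in atTop, ∀ x ∈ t,
        ‖(n : ℝ)⁻¹ • ∑ i ∈ Finset.range n, hess f x (Zs i ω) - H x‖ < c / 4 := by
      rw [eventually_all_finite htfin]
      intro x hx
      have := (tendsto_iff_norm_sub_tendsto_zero.mp (hω2 x hx)).eventually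
        (Iio_mem_nhds (show 0 < c / 4 by positivity))
      exact this
    filter_upwards [a1, a2] with n hn1 hn2
    simp only [hE, mem_inter_iff, mem_iInter, mem_ofPred_eq]
    exact ⟨hn1, hn2⟩
  refine ⟨c / 2, |K| + c, by positivity, by positivity, ?_⟩
  refine tendsto_of_tendsto_of_tendsto_of_le_of_le tendsto_const_nhds
    (tendsto_measure_compl_of_ae_eventually hEm hEev) (fun n => zero_le) (fun n => ?_)
  -- The event that the quadratic bounds fail is not shown to be measurable. It is covered, up to a
  -- null set, by the complement of the measurable event `E n`.
  refine measure_mono_ae ?_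
  filter_upwards [hLip] with ω hω hbad hgood
  refine hbad ?_
  simp only [hE, mem_inter_iff, mem_iInter, mem_ofPred_eq] at hgood
  obtain ⟨hg1, hg2⟩ := hgood
  refine QuadBounds.of_hessian (sampleAverage_contDiff h.contDiff _ n) fun x hx u => ?_
  rw [fderiv_gradient_sampleAverage h.contDiff]
  obtain ⟨y, hy, hxy⟩ := mem_iUnion₂.mp (hcover hx)
  rw [mem_ball_iff_norm] at hxy
  set A := (n : ℝ)⁻¹ • ∑ i ∈ Finset.range n, hess f x (Zs i ω)
  have d1 : ‖A - (n : ℝ)⁻¹ • ∑ i ∈ Finset.range n, hess f y (Zs i ω)‖ ≤ c / 4 := by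
    refine (norm_average_sub_le (fun i => hω i x hx y (htsub hy)) n).trans ?_
    calc _ ≤ (m + 1) * η := by gcongr
      _ = c / 4 := by rw [hη]; field_simp
  have d2 : ‖A - H y‖ ≤ c / 2 := by
    have := norm_sub_le_norm_sub_add_norm_sub A
      ((n : ℝ)⁻¹ • ∑ i ∈ Finset.range n, hess f y (Zs i ω)) (H y)
    linarith [hg2 y hy]
  have d3 : |⟪(A - H y) u, u⟫| ≤ c / 2 * ‖u‖ ^ 2 :=
    (abs_inner_apply_le _ _).trans (by gcongr)
  have d4 : |⟪(H y) u, u⟫| ≤ |K| * ‖u‖ ^ 2 :=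
    (abs_inner_apply_le _ _).trans (by gcongr; exact (hK y hy).trans (le_abs_self K))
  have d5 := hH y (htsub hy) u
  rw [sub_apply, inner_sub_left, abs_le] at d3
  rw [abs_le] at d4
  have : 0 ≤ c * ‖u‖ ^ 2 := by positivity
  constructor <;> linarith [d3.1, d3.2, d4.2]

end Probability

end GDBLS

/-! ### A moment inequality of order `p ∈ (1, 2]` for sums of independent centered vectors. -/

namespace GDBLS

open scoped RealInnerProductSpace

/-- If `‖a‖ ≤ ‖b‖`, everything is of order `‖b‖ ^ p`: `4` for the left side and at most `2` for the
inner product. Otherwise, write `‖a + b‖² = ‖a‖² (1 + s)` and apply Bernoulli's inequality with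
exponent `p / 2 ≤ 1`; the quadratic remainder is at most `‖b‖ ^ p` because `p - 2 ≤ 0`. -/
theorem norm_add_rpow_le {E : Type*} [NormedAddCommGroup E] [InnerProductSpace ℝ E] {p : ℝ}
    (hp1 : 1 ≤ p) (hp2 : p ≤ 2) (a b : E) :
    ‖a + b‖ ^ p ≤ ‖a‖ ^ p + p * ⟪‖a‖ ^ (p - 2) • a, b⟫ + 6 * ‖b‖ ^ p := by
  rw [inner_smul_left, conj_trivial]
  have hbp : 0 ≤ ‖b‖ ^ p := by positivity
  rcases le_or_gt ‖a‖ ‖b‖ with hab | hab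
  · have h1 : ‖a + b‖ ^ p ≤ 4 * ‖b‖ ^ p := by
      calc ‖a + b‖ ^ p ≤ (2 * ‖b‖) ^ p := by
            gcongr
            linarith [norm_add_le a b]
        _ = 2 ^ p * ‖b‖ ^ p := Real.mul_rpow (by norm_num) (norm_nonneg _)
        _ ≤ 2 ^ (2 : ℝ) * ‖b‖ ^ p := by
            gcongr
            norm_num
        _ = 4 * ‖b‖ ^ p := by norm_num
    have h2 : -(‖b‖ ^ p) ≤ ‖a‖ ^ (p - 2) * ⟪a, b⟫ := by
      rcases (norm_nonneg a).eq_or_lt with ha | ha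
      · have : a = 0 := norm_eq_zero.mp ha.symm
        simp [this, hbp]
      · have e : ‖a‖ ^ (p - 2) * ‖a‖ = ‖a‖ ^ (p - 1) := by
          rw [← Real.rpow_add_one ha.ne']; congr 1; ring
        have e' : ‖b‖ ^ (p - 1) * ‖b‖ = ‖b‖ ^ p := by
          rw [← Real.rpow_add_one (ha.trans_le hab).ne']; congr 1; ring
        have h3 := (abs_le.mp (abs_real_inner_le_norm a b)).1
        calc -(‖b‖ ^ p) = -(‖b‖ ^ (p - 1) * ‖b‖) := by rw [e']
          _ ≤ -(‖a‖ ^ (p - 1) * ‖b‖) := by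
            have : ‖a‖ ^ (p - 1) ≤ ‖b‖ ^ (p - 1) :=
              Real.rpow_le_rpow ha.le hab (by linarith)
            gcongr
          _ = ‖a‖ ^ (p - 2) * (-(‖a‖ * ‖b‖)) := by rw [← e]; ring
          _ ≤ _ := by gcongr
    have h4 : 0 ≤ ‖a‖ ^ p := by positivity
    nlinarith
  · have ha : 0 < ‖a‖ := (norm_nonneg b).trans_lt hab
    set s := (2 * ⟪a, b⟫ + ‖b‖ ^ 2) / ‖a‖ ^ 2 with hs
    have hsum : ‖a + b‖ ^ 2 = ‖a‖ ^ 2 * (1 + s) := by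
      rw [norm_add_sq_real, hs]; field_simp; ring
    have hs1 : -1 ≤ s := by
      have : 0 ≤ ‖a‖ ^ 2 * (1 + s) := hsum ▸ sq_nonneg _
      have := nonneg_of_mul_nonneg_right this (by positivity)
      linarith
    have e1 : ∀ x : ℝ, 0 ≤ x → x ^ p = (x ^ 2) ^ (p / 2) := fun x hx => by
      rw [← Real.rpow_natCast, ← Real.rpow_mul hx]
      congr 1
      push_cast
      ring
    have h1 := rpow_one_add_le_one_add_mul_self hs1 (show 0 ≤ p / 2 by linarith)
      (show p / 2 ≤ 1 by linarith)
    have hap : ‖a‖ ^ p = ‖a‖ ^ (p - 2) * ‖a‖ ^ 2 := by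
      rw [← Real.rpow_natCast, ← Real.rpow_add ha]
      norm_num
    have h2 : ‖a + b‖ ^ p ≤ ‖a‖ ^ p * (1 + p / 2 * s) := by
      rw [e1 _ (norm_nonneg _), hsum, Real.mul_rpow (by positivity) (by linarith),
        ← e1 _ ha.le]
      gcongr
    have h3 : ‖a‖ ^ p * (1 + p / 2 * s) =
        ‖a‖ ^ p + p * (‖a‖ ^ (p - 2) * ⟪a, b⟫) + p / 2 * (‖a‖ ^ (p - 2) * ‖b‖ ^ 2) := by
      have : ‖a‖ ^ 2 * s = 2 * ⟪a, b⟫ + ‖b‖ ^ 2 := by rw [hs]; field_simp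
      rw [mul_add, mul_one, hap]
      linear_combination (p / 2 * ‖a‖ ^ (p - 2)) * this
    have h4 : ‖a‖ ^ (p - 2) * ‖b‖ ^ 2 ≤ ‖b‖ ^ p := by
      rcases (norm_nonneg b).eq_or_lt with hb | hb
      · rw [← hb]
        simp [Real.zero_rpow (show p ≠ 0 by linarith)]
      · have : ‖b‖ ^ p = ‖b‖ ^ (p - 2) * ‖b‖ ^ 2 := by
          rw [← Real.rpow_natCast, ← Real.rpow_add hb]
          norm_num
        rw [this]
        gcongr 1
        exact Real.rpow_le_rpow_of_nonpos hb hab.le (by linarith)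
    have h5 : 0 ≤ ‖a‖ ^ (p - 2) * ‖b‖ ^ 2 := by positivity
    nlinarith

theorem norm_rpow_smul_self_le {E : Type*} [NormedAddCommGroup E] [NormedSpace ℝ E] {p : ℝ}
    (hp1 : 1 < p) (a : E) : ‖‖a‖ ^ (p - 2) • a‖ = ‖a‖ ^ (p - 1) := by
  rw [norm_smul, Real.norm_of_nonneg (by positivity)]
  rcases (norm_nonneg a).eq_or_lt with ha | ha
  · rw [← ha, mul_zero, Real.zero_rpow (by linarith)]
  · rw [← Real.rpow_add_one ha.ne']
    congr 1
    ring

section Moments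

variable {Ω : Type*} [MeasurableSpace Ω] {P : Measure Ω} {E : Type*} [NormedAddCommGroup E]
  [InnerProductSpace ℝ E] [CompleteSpace E] [MeasurableSpace E] [BorelSpace E]
  [SecondCountableTopology E]

/-- A von Bahr–Esseen type moment inequality for sums of independent centered vectors. -/
theorem integral_norm_sum_rpow_le [IsProbabilityMeasure P] {X : ℕ → Ω → E} {p K : ℝ}
    (hp1 : 1 < p) (hp2 : p ≤ 2) (hX : ∀ i, Measurable (X i)) (hindep : iIndepFun X P)
    (hint : ∀ i, Integrable (X i) P) (hmean : ∀ i, ∫ ω, X i ω ∂P = 0)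
    (hpi : ∀ i, Integrable (fun ω => ‖X i ω‖ ^ p) P) (hK : ∀ i, ∫ ω, ‖X i ω‖ ^ p ∂P ≤ K) (n : ℕ) :
    Integrable (fun ω => ‖∑ i ∈ Finset.range n, X i ω‖ ^ p) P ∧
      ∫ ω, ‖∑ i ∈ Finset.range n, X i ω‖ ^ p ∂P ≤ 6 * K * n := by
  induction n with
  | zero => simp [Real.zero_rpow (show p ≠ 0 by linarith)]
  | succ n ih =>
    obtain ⟨ih1, ih2⟩ := ih
    set S : Ω → E := fun ω => ∑ i ∈ Finset.range n, X i ω with hS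
    have hSm : Measurable S := Finset.measurable_fun_sum _ fun i _ => hX i
    let φ : E → E := fun a => ‖a‖ ^ (p - 2) • a
    have hφm : Measurable φ := (measurable_norm.pow_const (p - 2)).smul measurable_id
    have hφS : Integrable (fun ω => φ (S ω)) P := by
      refine ((integrable_const (1 : ℝ)).add ih1).mono' (hφm.comp hSm).aestronglyMeasurable
        (ae_of_all _ fun ω => ?_)
      simp only [φ, norm_rpow_smul_self_le hp1, Pi.add_apply]
      rcases le_total ‖S ω‖ 1 with h1 | h1
      · have h2 := Real.rpow_le_one (norm_nonneg (S ω)) h1 (show 0 ≤ p - 1 by linarith)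
        have : 0 ≤ ‖S ω‖ ^ p := by positivity
        linarith
      · have := Real.rpow_le_rpow_of_exponent_le h1 (show p - 1 ≤ p by linarith)
        linarith
    have hind : (fun ω => φ (S ω)) ⟂ᵢ[P] X n := by
      have h0 := hindep.indepFun_finsetSum_of_notMem hX (s := Finset.range n) (i := n) (by simp)
      have e : (∑ j ∈ Finset.range n, X j) = S := by
        funext ω; simp [hS]
      rw [e] at h0
      exact h0.comp hφm measurable_id
    -- The linear term vanishes in expectation because `X n` is centered and independent of the
    -- partial sum, so each summand adds at most `6 * K`.
    have hcross : ∫ ω, ⟪φ (S ω), X n ω⟫ ∂P = 0 := by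
      have := hind.integral_bilin hφS (hint n) (innerSL ℝ)
      rw [hmean n, map_zero] at this
      exact this
    have hcrossi : Integrable (fun ω => ⟪φ (S ω), X n ω⟫) P := by
      refine (ih1.add (hpi n)).mono' ((hφm.comp hSm).inner (hX n)).aestronglyMeasurable
        (ae_of_all _ fun ω => ?_)
      refine (norm_inner_le_norm _ _).trans ?_
      simp only [φ, norm_rpow_smul_self_le hp1, Pi.add_apply]
      have hmul : ∀ x : ℝ, 0 ≤ x → x ^ (p - 1) * x = x ^ p := fun x hx => by
        rcases hx.eq_or_lt with h | h
        · rw [← h, mul_zero, Real.zero_rpow (by linarith)]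
        · rw [← Real.rpow_add_one h.ne']; congr 1; ring
      have h1 : 0 ≤ ‖S ω‖ ^ p := by positivity
      have h2 : 0 ≤ ‖X n ω‖ ^ p := by positivity
      rcases le_total ‖S ω‖ ‖X n ω‖ with h | h
      · calc ‖S ω‖ ^ (p - 1) * ‖X n ω‖ ≤ ‖X n ω‖ ^ (p - 1) * ‖X n ω‖ := by gcongr
          _ = ‖X n ω‖ ^ p := hmul _ (norm_nonneg _)
          _ ≤ _ := by simpa [hS] using h1
      · calc ‖S ω‖ ^ (p - 1) * ‖X n ω‖ ≤ ‖S ω‖ ^ (p - 1) * ‖S ω‖ := by gcongr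
          _ = ‖S ω‖ ^ p := hmul _ (norm_nonneg _)
          _ ≤ _ := by simpa [hS] using h2
    have hpt : ∀ ω, ‖∑ i ∈ Finset.range (n + 1), X i ω‖ ^ p ≤
        ‖S ω‖ ^ p + p * ⟪φ (S ω), X n ω⟫ + 6 * ‖X n ω‖ ^ p := fun ω => by
      rw [Finset.sum_range_succ]
      exact norm_add_rpow_le hp1.le hp2 _ _
    have hsum : Integrable (fun ω => ‖S ω‖ ^ p + p * ⟪φ (S ω), X n ω⟫) P :=
      ih1.add (hcrossi.const_mul p)
    have hdom : Integrable (fun ω => ‖S ω‖ ^ p + p * ⟪φ (S ω), X n ω⟫ + 6 * ‖X n ω‖ ^ p) P :=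
      hsum.add ((hpi n).const_mul 6)
    have hi : Integrable (fun ω => ‖∑ i ∈ Finset.range (n + 1), X i ω‖ ^ p) P := by
      refine hdom.mono' ?_ (ae_of_all _ fun ω => ?_)
      · have : Measurable (fun ω => ∑ i ∈ Finset.range (n + 1), X i ω) :=
          Finset.measurable_fun_sum _ fun i _ => hX i
        exact (this.norm.pow_const p).aestronglyMeasurable
      · rw [Real.norm_of_nonneg (by positivity)]
        exact hpt ω
    refine ⟨hi, (integral_mono hi hdom hpt).trans ?_⟩
    rw [integral_add hsum ((hpi n).const_mul 6), integral_add (show Integrable (fun ω =>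
      ‖S ω‖ ^ p) P from ih1) (hcrossi.const_mul p), integral_const_mul, integral_const_mul, hcross]
    push_cast
    linarith [hK n]

theorem measure_norm_sum_ge_le [IsProbabilityMeasure P] {X : ℕ → Ω → E} {p K : ℝ}
    (hp1 : 1 < p) (hp2 : p ≤ 2) (hX : ∀ i, Measurable (X i)) (hindep : iIndepFun X P)
    (hint : ∀ i, Integrable (X i) P) (hmean : ∀ i, ∫ ω, X i ω ∂P = 0)
    (hpi : ∀ i, Integrable (fun ω => ‖X i ω‖ ^ p) P) (hK : ∀ i, ∫ ω, ‖X i ω‖ ^ p ∂P ≤ K) {n : ℕ}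
    (hn : 0 < n) {t : ℝ} (ht : 0 < t) :
    P {ω | t * (n : ℝ) ^ (1 / p) ≤ ‖∑ i ∈ Finset.range n, X i ω‖} ≤
      ENNReal.ofReal (6 * K / t ^ p) := by
  obtain ⟨h1, h2⟩ := integral_norm_sum_rpow_le hp1 hp2 hX hindep hint hmean hpi hK n
  have hn' : (0 : ℝ) < n := by exact_mod_cast hn
  have hm := mul_meas_ge_le_integral_of_nonneg (ae_of_all P fun ω => by positivity) h1 (t ^ p * n)
  have hsub : {ω | t * (n : ℝ) ^ (1 / p) ≤ ‖∑ i ∈ Finset.range n, X i ω‖} ⊆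
      {ω | t ^ p * n ≤ ‖∑ i ∈ Finset.range n, X i ω‖ ^ p} := by
    intro ω hω
    rw [mem_ofPred_eq] at hω ⊢
    calc t ^ p * n = (t * (n : ℝ) ^ (1 / p)) ^ p := by
          rw [Real.mul_rpow ht.le (by positivity), ← Real.rpow_mul hn'.le,
            one_div_mul_cancel (by linarith), Real.rpow_one]
      _ ≤ _ := by gcongr
  refine (measure_mono hsub).trans ?_
  rw [ENNReal.le_ofReal_iff_toReal_le (measure_ne_top _ _) (by
    have : 0 ≤ K := (integral_nonneg fun ω => by positivity).trans (hK 0)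
    positivity), le_div_iff₀ (by positivity)]
  rw [measureReal_def] at hm
  have : (n : ℝ) * (t ^ p * (P {ω | t ^ p * n ≤ ‖∑ i ∈ Finset.range n, X i ω‖ ^ p}).toReal)
      ≤ n * (6 * K) := by linarith
  linarith [le_of_mul_le_mul_left this hn']

end Moments

end GDBLS

/-! ### Conversion to rates, and the main theorem. -/

namespace GDBLS

open scoped RealInnerProductSpace

theorem gdBLS_of_budget {d : ℕ} {𝒵 : Type*} {Cgrad Ceval : ℕ}
    (f : EuclideanSpace ℝ (Fin d) → 𝒵 → ℝ) (zs : ℕ → 𝒵) (θ₀ : EuclideanSpace ℝ (Fin d))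
    {n B : ℕ} (τ β : ℝ) (hB : n * Cgrad + n * Ceval ≤ B) :
    gdBLS Cgrad Ceval f zs θ₀ n B τ β = descentLoop (sampleAverage f zs n) (n * Cgrad) (n * Ceval)
      τ β θ₀ (gradient (sampleAverage f zs n) θ₀) (sampleAverage f zs n θ₀)
      (B - n * Cgrad - n * Ceval) := by
  have h1 : n * Cgrad ≤ B := by omega
  have h2 : n * Ceval ≤ B - n * Cgrad := by omega
  simp only [gdBLS, if_pos h1, if_pos h2]

/-- Since `exp (-x) ≤ 1 / x`, exponential decay in `B / n` is more than enough for the order `n /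
B`. The second `κ` in `2 * κ` pays for the two initial evaluations, which cost less than one full
pass. -/
theorem exp_remaining_budget_le {κ : ℝ} (hκ : 0 < κ) {Cgrad Ceval k n B : ℕ} (hCeval : 0 < Ceval)
    (hn : 0 < n) (hB : n * Cgrad + n * Ceval ≤ B) :
    Real.exp (κ - κ * ((B - n * Cgrad - n * Ceval : ℕ) /
      ((k + 2) * (n * Ceval) + n * Cgrad : ℕ))) ≤
      Real.exp (2 * κ) * (((k + 2) * Ceval + Cgrad : ℕ) / κ) * (n / B) := by
  set N : ℕ := (k + 2) * Ceval + Cgrad with hN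
  have hNpos : (0 : ℝ) < N := by
    have : 0 < N := by positivity
    exact_mod_cast this
  have hn' : (0 : ℝ) < n := by exact_mod_cast hn
  have hB' : (0 : ℝ) < B := by
    have : 0 < n * Ceval := by positivity
    have : 0 < B := by omega
    exact_mod_cast this
  have e : (k + 2) * (n * Ceval) + n * Cgrad = n * N := by rw [hN]; ring
  rw [e]
  push_cast
  have h1 : (B : ℝ) / (n * N) - 1 ≤ (B - n * Cgrad - n * Ceval : ℕ) / (n * N) := by
    rw [div_sub_one (by positivity)]
    gcongr
    have : B ≤ (B - n * Cgrad - n * Ceval) + n * N := by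
      have : n * N = n * Cgrad + n * Ceval + n * ((k + 1) * Ceval) := by rw [hN]; ring
      omega
    have : (B : ℝ) ≤ ((B - n * Cgrad - n * Ceval) + n * N : ℕ) := by exact_mod_cast this
    push_cast at this
    linarith
  set x := κ * ((B : ℝ) / (n * N)) with hx
  have hx0 : 0 < x := by positivity
  have h2 : Real.exp (-x) ≤ x⁻¹ := by
    rw [Real.exp_neg]
    exact inv_anti₀ hx0 (by linarith [Real.add_one_le_exp x])
  calc _ ≤ Real.exp (2 * κ + -x) := by
        gcongr
        have := mul_le_mul_of_nonneg_left h1 hκ.le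
        rw [mul_sub, mul_one, ← hx] at this
        linarith
    _ = Real.exp (2 * κ) * Real.exp (-x) := Real.exp_add _ _
    _ ≤ Real.exp (2 * κ) * x⁻¹ := by gcongr
    _ = _ := by rw [hx]; field_simp

theorem one_le_mul_rate {α : ℝ} (hα : 0 < α) {n : ℕ → ℕ} {B : ℕ} (hn : 0 < n B) (hB : 0 < B) :
    1 ≤ (B : ℝ) ^ (α / (1 + 3 * α)) * rate α n B := by
  have hn' : (1 : ℝ) ≤ n B := by exact_mod_cast hn
  have hB' : (1 : ℝ) ≤ B := by exact_mod_cast hB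
  have hn0 : (0 : ℝ) < n B := by linarith
  have hB0 : (0 : ℝ) < B := by linarith
  have hBpos : 0 < (B : ℝ) ^ (α / (1 + 3 * α)) := by positivity
  suffices h : (B : ℝ) ^ (-(α / (1 + 3 * α))) ≤ rate α n B by
    calc (1 : ℝ) = (B : ℝ) ^ (α / (1 + 3 * α)) * (B : ℝ) ^ (-(α / (1 + 3 * α))) := by
          rw [← Real.rpow_add hB0, add_neg_cancel, Real.rpow_zero]
      _ ≤ _ := by gcongr
  rw [rate, le_max_iff]
  -- This power of `B` is the sample size at which the two terms of the rate are equal. Above it the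
  -- optimization term is the large one, below it the statistical term.
  rcases le_total ((B : ℝ) ^ ((1 + α) / (1 + 3 * α))) (n B) with h | h
  · left
    apply Real.le_sqrt_of_sq_le
    rw [le_div_iff₀ hB0]
    calc ((B : ℝ) ^ (-(α / (1 + 3 * α)))) ^ 2 * B
        = (B : ℝ) ^ ((1 + α) / (1 + 3 * α)) := by
          rw [← Real.rpow_natCast, ← Real.rpow_mul hB0.le, ← Real.rpow_add_one hB0.ne']
          congr 1
          push_cast
          field_simp
          ring
      _ ≤ n B := h
  · right
    calc (B : ℝ) ^ (-(α / (1 + 3 * α)))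
        = ((B : ℝ) ^ ((1 + α) / (1 + 3 * α))) ^ (-(α / (1 + α))) := by
          rw [← Real.rpow_mul hB0.le]
          congr 1
          field_simp
      _ ≤ (n B : ℝ) ^ (-(α / (1 + α))) :=
          Real.rpow_le_rpow_of_nonpos hn0 h (by
            have : 0 ≤ α / (1 + α) := by positivity
            linarith)

theorem SmoothMoment.measure_gradient_gt_le {d : ℕ} {Ω 𝒵 : Type*} [MeasurableSpace Ω]
    [MeasurableSpace 𝒵] {P : Measure Ω} [IsProbabilityMeasure P] {Z : Ω → 𝒵}
    {f : EuclideanSpace ℝ (Fin d) → 𝒵 → ℝ} {θs : EuclideanSpace ℝ (Fin d)} {α : ℝ}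
    (h : SmoothMoment P Z f θs α) (hα : α ∈ Ioc (0 : ℝ) 1) (hf : ∀ x, Measurable (f x))
    (hZ : Measurable Z) {Zs : ℕ → Ω → 𝒵} (hZs : ∀ i, Measurable (Zs i)) (hindep : iIndepFun Zs P)
    (hident : ∀ i, IdentDistrib (Zs i) Z P P) (hint : ∀ θ, Integrable (fun ω => f θ (Z ω)) P)
    (hmin : ∀ θ, objective P Z f θs ≤ objective P Z f θ) {ε : ℝ} (hε : 0 < ε) :
    ∃ t : ℝ, 0 < t ∧ ∀ n : ℕ, 0 < n → P {ω | t * (n : ℝ) ^ (-(α / (1 + α))) <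
      ‖gradient (sampleAverage f (fun i => Zs i ω) n) θs‖} ≤ ENNReal.ofReal ε := by
  have hgm := measurable_grad hf h.contDiff θs
  have hid : ∀ i, IdentDistrib (fun ω => grad f θs (Zs i ω)) (fun ω => grad f θs (Z ω)) P P :=
    fun i => (hident i).comp hgm
  have hidp : ∀ i, IdentDistrib (fun ω => ‖grad f θs (Zs i ω)‖ ^ (1 + α))
      (fun ω => ‖grad f θs (Z ω)‖ ^ (1 + α)) P P :=
    fun i => (hident i).comp (hgm.norm.pow_const (1 + α))
  set K := ∫ ω, ‖grad f θs (Z ω)‖ ^ (1 + α) ∂P with hK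
  have hK0 : 0 ≤ K := integral_nonneg fun ω => by positivity
  have hα0 := hα.1
  have ht1 : 1 ≤ 6 * K / ε + 1 := by
    have : 0 ≤ 6 * K / ε := by positivity
    linarith
  -- This `t` satisfies `6 * K ≤ ε * t`, and `t ≥ 1` gives `t ≤ t ^ (1 + α)`; hence the tail bound
  -- `6 * K / t ^ (1 + α)` is at most `ε`.
  refine ⟨6 * K / ε + 1, by positivity, fun n hn => ?_⟩
  have hn' : (0 : ℝ) < n := by exact_mod_cast hn
  have hm := measure_norm_sum_ge_le (P := P) (X := fun i ω => grad f θs (Zs i ω)) (p := 1 + α)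
    (by linarith) (by linarith [hα.2]) (fun i => hgm.comp (hZs i))
    (hindep.comp (fun _ => grad f θs) fun _ => hgm)
    (fun i => (hid i).symm.integrable_snd (h.integrable_grad hα0.le hf hZ))
    (fun i => (hid i).integral_eq.trans (h.integral_grad_eq_zero hα0.le hf hZ hint hmin))
    (fun i => (hidp i).symm.integrable_snd h.grad_integrable)
    (fun i => (hidp i).integral_eq.le) hn (t := 6 * K / ε + 1) (by positivity)
  refine (measure_mono ?_).trans (hm.trans (ENNReal.ofReal_le_ofReal ?_))
  · intro ω hω
    rw [mem_ofPred_eq] at hω ⊢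
    rw [gradient_sampleAverage h.contDiff, norm_smul, Real.norm_of_nonneg (by positivity)] at hω
    have e : (n : ℝ) ^ (1 / (1 + α)) = n * (n : ℝ) ^ (-(α / (1 + α))) := by
      rw [mul_comm, ← Real.rpow_add_one hn'.ne']
      congr 1
      field_simp
      ring
    have := mul_le_mul_of_nonneg_left hω.le hn'.le
    rw [mul_inv_cancel_left₀ hn'.ne'] at this
    rw [e]
    linarith
  · rw [div_le_iff₀ (by positivity)]
    have h1 : 6 * K / ε + 1 ≤ (6 * K / ε + 1) ^ (1 + α) :=
      Real.self_le_rpow_of_one_le ht1 (by linarith)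
    have h2 : ε * (6 * K / ε + 1) ≤ ε * (6 * K / ε + 1) ^ (1 + α) := by gcongr
    have h3 : ε * (6 * K / ε + 1) = 6 * K + ε := by field_simp
    linarith

end GDBLS

open GDBLS
theorem theorem1 {Ω 𝒵 : Type*} [MeasurableSpace Ω] (P : Measure Ω) [IsProbabilityMeasure P]
    [TopologicalSpace 𝒵] [PolishSpace 𝒵] [MeasurableSpace 𝒵] [BorelSpace 𝒵]
    (d : ℕ) (f : EuclideanSpace ℝ (Fin d) → 𝒵 → ℝ) (hf : Measurable (Function.uncurry f))
    (Z : Ω → 𝒵) (hZ : Measurable Z)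
    (Zs : ℕ → Ω → 𝒵) (hZs : ∀ i, Measurable (Zs i))
    (hindep : iIndepFun Zs P) (hident : ∀ i, IdentDistrib (Zs i) Z P P)
    (hint : ∀ θ, Integrable (fun ω => f θ (Z ω)) P)
    (θs : EuclideanSpace ℝ (Fin d))
    (hmin : ∀ θ, GDBLS.objective P Z f θs ≤ GDBLS.objective P Z f θ)
    (hA1 : GDBLS.LocallyStronglyConvex (GDBLS.objective P Z f))
    (α : ℝ) (hα : α ∈ Ioc (0 : ℝ) 1) (hA2 : GDBLS.SmoothMoment P Z f θs α)
    (Cgrad Ceval : ℕ) (hCgrad : 0 < Cgrad) (hCeval : 0 < Ceval)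
    (θ₀ : EuclideanSpace ℝ (Fin d)) (β : ℝ) (hβ : β ∈ Ioo (0 : ℝ) 1)
    (n : ℕ → ℕ) (hnB : Tendsto (fun B : ℕ => (n B : ℝ) / (B : ℝ)) atTop (𝓝 0))
    (hn : Tendsto n atTop atTop) :
    GDBLS.IsBigOInProb P
        (fun B ω => ‖(GDBLS.gdBLS Cgrad Ceval f (fun i => Zs i ω) θ₀ (n B) B 0 β).1 - θs‖)
        (GDBLS.rate α n) ∧
      0 < liminf (fun B : ℕ =>
        (((B : ℝ) ^ (α / (1 + 3 * α)) * GDBLS.rate α n B : ℝ) : EReal)) atTop := by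
  have hα0 := hα.1
  have hnpos : ∀ᶠ B in atTop, 0 < n B := hn.eventually_gt_atTop 0
  refine ⟨?_, ?_⟩
  · intro ε hε
    have hfm : ∀ x, Measurable (f x) := fun x => hf.of_uncurry_left
    choose c L hc hL hQ using hA2.exists_quadBounds hfm hZ hZs hindep hident hint hA1
    obtain ⟨ρ₁, ρ₂, ρ₃, γ₀, c₀, K₁, κ, k, hγ₀, hK₁, hκ, herr⟩ :=
      descentLoop_error hβ θs θ₀ c L hc hL
    obtain ⟨t, ht, hgrad⟩ := hA2.measure_gradient_gt_le hα hfm hZ hZs hindep hident hint hmin hε.1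
    set K₂ := Real.exp (2 * κ) * (((k + 2) * Ceval + Cgrad : ℕ) / κ) with hK₂
    have hK₂0 : 0 ≤ K₂ := by positivity
    set A := 4 / c₀ ^ 2 * t ^ 2 + K₁ * K₂ with hA
    have hA0 : 0 ≤ A := by positivity
    -- On the good event the normalized error is at most `√A`. The added `1` makes the non-strict
    -- event `M ≤ |X / a|` impossible there.
    refine ⟨Real.sqrt A + 1, ?_⟩
    have hlim : Tendsto (fun B => ENNReal.ofReal ε +
        (P {ω | ¬ QuadBounds (sampleAverage f (fun i => Zs i ω) (n B)) θs ρ₁ (c ρ₁) (L ρ₁)} +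
        P {ω | ¬ QuadBounds (sampleAverage f (fun i => Zs i ω) (n B)) θs ρ₂ (c ρ₂) (L ρ₂)} +
        P {ω | ¬ QuadBounds (sampleAverage f (fun i => Zs i ω) (n B)) θs ρ₃ (c ρ₃) (L ρ₃)}))
        atTop (𝓝 (ENNReal.ofReal ε)) := by
      have := ((((hQ ρ₁).comp hn).add ((hQ ρ₂).comp hn)).add ((hQ ρ₃).comp hn)).const_add
        (ENNReal.ofReal ε)
      simpa using this
    rw [← hlim.limsup_eq]
    refine limsup_le_limsup ?_
    have hγev : ∀ᶠ B in atTop, t * (n B : ℝ) ^ (-(α / (1 + α))) ≤ γ₀ := by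
      have h1 : Tendsto (fun B => t * (n B : ℝ) ^ (-(α / (1 + α)))) atTop (𝓝 (t * 0)) :=
        ((tendsto_rpow_neg_atTop (by positivity)).comp
          (tendsto_natCast_atTop_atTop.comp hn)).const_mul t
      rw [mul_zero] at h1
      exact (h1.eventually (Iio_mem_nhds hγ₀)).mono fun B hB => le_of_lt hB
    have hBev : ∀ᶠ B in atTop, n B * Cgrad + n B * Ceval ≤ B := by
      have hC : (0 : ℝ) < Cgrad + Ceval := by positivity
      filter_upwards [hnB.eventually (Iio_mem_nhds (inv_pos.mpr hC)), eventually_gt_atTop 0]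
        with B hB hB0
      have hB0' : (0 : ℝ) < B := by exact_mod_cast hB0
      rw [div_lt_iff₀ hB0', inv_mul_eq_div, lt_div_iff₀ hC] at hB
      have : (n B * Cgrad + n B * Ceval : ℝ) ≤ B := by linarith
      exact_mod_cast this
    filter_upwards [hγev, hBev, hnpos] with B hγB hBB hnB0
    have hn' : (0 : ℝ) < n B := by exact_mod_cast hnB0
    refine le_trans (measure_mono ?_) ((measure_union_le {ω | t * (n B : ℝ) ^ (-(α / (1 + α))) <
      ‖gradient (sampleAverage f (fun i => Zs i ω) (n B)) θs‖} _).trans (add_le_add (hgrad _ hnB0)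
      ((measure_union_le _ _).trans (add_le_add (measure_union_le _ _) le_rfl))))
    intro ω hω
    by_contra hbad
    simp only [mem_union, mem_ofPred_eq, not_or, not_not, not_lt] at hbad
    obtain ⟨hg, ⟨h1, h2⟩, h3⟩ := hbad
    have hE := herr _ h1 h2 h3 (hg.trans hγB) (n B * Cgrad) (n B * Ceval)
      (B - n B * Cgrad - n B * Ceval) (by positivity)
    rw [← gdBLS_of_budget f (fun i => Zs i ω) θ₀ 0 β hBB] at hE
    have hexp := exp_remaining_budget_le (k := k) hκ hCeval hnB0 hBB
    rw [← hK₂] at hexp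
    have hr1 : (n B : ℝ) ^ (-(α / (1 + α))) ≤ rate α n B := le_max_right _ _
    have hr2 : Real.sqrt ((n B : ℝ) / B) ≤ rate α n B := le_max_left _ _
    have hrpos : 0 < rate α n B := lt_of_lt_of_le (by positivity) hr1
    have hr3 : (n B : ℝ) / B ≤ rate α n B ^ 2 := (Real.sqrt_le_left hrpos.le).mp hr2
    have hfin : ‖(gdBLS Cgrad Ceval f (fun i => Zs i ω) θ₀ (n B) B 0 β).1 - θs‖ ^ 2 ≤
        A * rate α n B ^ 2 := by
      refine hE.trans ?_
      calc _ ≤ 4 / c₀ ^ 2 * (t * rate α n B) ^ 2 + K₁ * (K₂ * rate α n B ^ 2) := by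
            gcongr
            · exact hg.trans (by gcongr)
            · exact hexp.trans (by gcongr)
        _ = A * rate α n B ^ 2 := by rw [hA]; ring
    have hle : ‖(gdBLS Cgrad Ceval f (fun i => Zs i ω) θ₀ (n B) B 0 β).1 - θs‖ ≤
        Real.sqrt A * rate α n B := by
      have := Real.le_sqrt_of_sq_le hfin
      rwa [Real.sqrt_mul hA0, Real.sqrt_sq hrpos.le] at this
    rw [mem_ofPred_eq, abs_of_nonneg (by positivity), le_div_iff₀ hrpos] at hω
    linarith
  · refine lt_of_lt_of_le zero_lt_one (le_liminf_of_le (by isBoundedDefault) ?_)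
    filter_upwards [hnpos, eventually_gt_atTop 0] with B hnB0 hB0
    exact_mod_cast one_le_mul_rate hα0 hnB0 hB0
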